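/- Let $d\ge 0$, let $\mathbb J=\begin{bmatrix}0&I_d\\-I_d&0\end{bmatrix}$, and let $\mathsf{Sp}(\mathbb R^{2d})=\{S\in\mathsf M(2d,\mathbb R): S^T\mathbb JS=\mathbb J\}$ act on the Siegel upper half space $\mathbb H_d=\{\mathcal C=\mathcal A+\mathrm i\mathcal B:\ \mathcal A,\mathcal B\in\mathsf{sym}(d,\mathbb R),\ \mathcal B>0\}$ by $\Phi_S(\mathcal C)=(S_{21}+S_{22}\mathcal C)(S_{11}+S_{12}\mathcal C)^{-1}$, where $S_{ij}$ are the $d\times d$ blocks of $S$. Equip $\mathbb H_d$ with the symplectic form $\Omega_{\mathbb H_d}=\mathcal B^{-1}_{lj}\mathcal B^{-1}_{km}\,d\mathcal B_{lm}\wedge d\mathcal A_{jk}=-d\mathcal B^{-1}_{jk}\wedge d\mathcal A_{jk}$ (summation over repeated indices) and the Poisson bracket $$\{F,G\}_{\mathbb H_d}=-\Bigl(\frac{\partial F}{\partial\mathcal B^{-1}_{jk}}\frac{\partial G}{\partial\mathcal A_{jk}}-\frac{\partial G}{\partial\mathcal B^{-1}_{jk}}\frac{\partial F}{\partial\mathcal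 A_{jk}}\Bigr),$$ where $\partial F/\partial\mathcal A$ and $\partial F/\partial\mathcal B^{-1}$ are the symmetric matrices with $dF=\operatorname{tr}\bigl(\tfrac{\partial F}{\partial\mathcal A}d\mathcal A\bigr)+\operatorname{tr}\bigl(\tfrac{\partial F}{\partial\mathcal B^{-1}}d\mathcal B^{-1}\bigr)$. On $\mathsf{sym}(2d,\mathbb R)$ put $[\xi,\eta]=\xi\mathbb J^T\eta-\eta\mathbb J^T\xi$ and $\langle\xi,\eta\rangle=\operatorname{tr}(\xi\eta)$. Identify $\mathsf{sym}(2d,\mathbb R)$ with $\mathfrak{sp}(\mathbb R^{2d})$ by $\xi\mapsto\tilde\xi=\mathbb J^T\xi$, and with its own dual, hence with $\mathfrak{sp}(\mathbb R^{2d})^*$, by $\langle\cdot,\cdot\rangle$. Then the coadjoint action is $\mathrm{Ad}^*_{S^{-1}}\mu=S\mu S^T$, and $\mathrm{ad}^*_\xi\mu=\mathbb J\xi\mu-\mu\xi\mathbb J$. A momentum map of $\Phi$ is a map $\mathbf J:\mathbb H_d\to\mathsf{sym}(2d,\mathbb R)$, differentiable on $\mathbb H_d$, such that $\iota_{\xi_{\mathbb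 H_d}}\Omega_{\mathbb H_d}=d\langle\mathbf J(\cdot),\xi\rangle$ for all $\xi\in\mathsf{sym}(2d,\mathbb R)$, where $\xi_{\mathbb H_d}(\mathcal C)=\frac{d}{d\varepsilon}\big|_{\varepsilon=0}\Phi_{\exp(\varepsilon\tilde\xi)}(\mathcal C)$. Let $$\sigma(\mathcal C)=\begin{bmatrix}\mathcal B^{-1}&\mathcal B^{-1}\mathcal A\\ \mathcal A\mathcal B^{-1}&\mathcal A\mathcal B^{-1}\mathcal A+\mathcal B\end{bmatrix}.$$ (i) $\mathbf J=\sigma$ is a momentum map of $\Phi$, and every momentum map of $\Phi$ equals $\sigma$ up to an additive constant in $\mathsf{sym}(2d,\mathbb R)$. (ii) $\sigma$ is equivariant: $\sigma\circ\Phi_S=\mathrm{Ad}^*_{S^{-1}}\sigma=S\sigma S^T$ for all $S\in\mathsf{Sp}(\mathbb R^{2d})$; it is the only equivariant momentum map of $\Phi$. (iii) $\sigma$ is a Poisson map for $\{\cdot,\cdot\}_{\mathbb H_d}$ and the $(+)$-Lie–Poisson bracket $\{F,G\}^+(\mu)=\bigl\langle\mu,\bigl[\tfrac{\delta F}{\delta\mu},\tfrac{\delta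 G}{\delta\mu}\bigr]\bigr\rangle$ on $\mathsf{sym}(2d,\mathbb R)$, where $\delta F/\delta\mu$ is the gradient with respect to $\langle\cdot,\cdot\rangle$: for $\mathcal C\in\mathbb H_d$ and $F,G$ differentiable at $\sigma(\mathcal C)$ (in particular for smooth $F,G$), $\{F,G\}^+(\sigma(\mathcal C))=\{F\circ\sigma,G\circ\sigma\}_{\mathbb H_d}(\mathcal C)$. (iv) $\sigma$ is differentiable and maps $\mathbb H_d$ onto a single coadjoint orbit $\mathcal O$, and $\sigma^*\Omega^+_{\mathcal O}=\Omega_{\mathbb H_d}$, where $\Omega^+_{\mathcal O}(\mu)(\mathrm{ad}^*_\xi\mu,\mathrm{ad}^*_\eta\mu)=\langle\mu,[\xi,\eta]\rangle$ is the $(+)$-Kirillov–Kostant–Souriau form on $\mathcal O$. -/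

import Mathlib

open Matrix

noncomputable section

namespace Siegel

/-- The real vector space `sym(n, ℝ)` of symmetric real matrices. -/
def Sym (n : Type) : Submodule ℝ (Matrix n n ℝ) where
  carrier := {M | M.IsSymm}
  add_mem' ha hb := ha.add hb
  zero_mem' := Matrix.isSymm_zero
  smul_mem' c _ ha := ha.smul c

lemma Sym.transpose_coe {n : Type} (ξ : Sym n) : (ξ : Matrix n n ℝ)ᵀ = ξ := ξ.2

/-! ### The Siegel upper half space -/

/-- The real vector space of complex symmetric `d × d` matrices `𝒞 = 𝒜 + i ℬ`, in the real linear
coordinates `(𝒜, ℬ)`. -/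
abbrev CSym (d : ℕ) : Type := Sym (Fin d) × Sym (Fin d)

/-- The complex matrix `𝒜 + i ℬ`. -/
def toComplex {d : ℕ} (C : CSym d) : Matrix (Fin d) (Fin d) ℂ :=
  (C.1 : Matrix (Fin d) (Fin d) ℝ).map Complex.ofReal +
    Complex.I • (C.2 : Matrix (Fin d) (Fin d) ℝ).map Complex.ofReal

/-- The Siegel upper half space `ℍ_d`: all `𝒜 + i ℬ` with `𝒜`, `ℬ` real symmetric and `ℬ > 0`.
It is an open subset of the real vector space `CSym d`, which is thus its tangent space at each
point. -/
def UpperHalfSpace (d : ℕ) : Set (CSym d) :=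
  {C | (C.2 : Matrix (Fin d) (Fin d) ℝ).PosDef}

/-! ### The action of the symplectic group by linear fractional transformations -/

/-- The denominator `S₁₁ + S₁₂ 𝒞`. -/
def denom {d : ℕ} (S : Matrix (Fin d ⊕ Fin d) (Fin d ⊕ Fin d) ℝ) (C : CSym d) :
    Matrix (Fin d) (Fin d) ℂ :=
  S.toBlocks₁₁.map Complex.ofReal + S.toBlocks₁₂.map Complex.ofReal * toComplex C

/-- The numerator `S₂₁ + S₂₂ 𝒞`. -/
def numer {d : ℕ} (S : Matrix (Fin d ⊕ Fin d) (Fin d ⊕ Fin d) ℝ) (C : CSym d) :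
    Matrix (Fin d) (Fin d) ℂ :=
  S.toBlocks₂₁.map Complex.ofReal + S.toBlocks₂₂.map Complex.ofReal * toComplex C

/-- The generalized linear fractional transformation `(S₂₁ + S₂₂ 𝒞) (S₁₁ + S₁₂ 𝒞)⁻¹`. -/
def fracMatrix {d : ℕ} (S : Matrix (Fin d ⊕ Fin d) (Fin d ⊕ Fin d) ℝ) (C : CSym d) :
    Matrix (Fin d) (Fin d) ℂ :=
  numer S C * (denom S C)⁻¹

lemma toComplex_transpose {d : ℕ} (C : CSym d) : (toComplex C)ᵀ = toComplex C := by
  rw [toComplex, Matrix.transpose_add, Matrix.transpose_smul, ← Matrix.transpose_map,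
    ← Matrix.transpose_map, Sym.transpose_coe, Sym.transpose_coe]

lemma ofReal_conjTranspose {m n : Type} (A : Matrix m n ℝ) :
    (A.map Complex.ofReal)ᴴ = Aᵀ.map Complex.ofReal := by
  ext i j; simp [Matrix.conjTranspose_apply]

lemma toComplex_conjTranspose {d : ℕ} (C : CSym d) :
    (toComplex C)ᴴ = toComplex C -
      (2 * Complex.I) • (C.2 : Matrix (Fin d) (Fin d) ℝ).map Complex.ofReal := by
  rw [toComplex, Matrix.conjTranspose_add, Matrix.conjTranspose_smul, ofReal_conjTranspose,
    ofReal_conjTranspose, Sym.transpose_coe, Sym.transpose_coe, Complex.star_def, Complex.conj_I]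
  module

lemma block_relations {d : ℕ} (S : symplecticGroup (Fin d) ℝ) :
    let f : Matrix (Fin d) (Fin d) ℝ → Matrix (Fin d) (Fin d) ℂ := fun M => M.map Complex.ofReal
    let T : Matrix (Fin d ⊕ Fin d) (Fin d ⊕ Fin d) ℝ := S
    (f T.toBlocks₁₁)ᵀ * f T.toBlocks₂₁ = (f T.toBlocks₂₁)ᵀ * f T.toBlocks₁₁ ∧
    (f T.toBlocks₁₂)ᵀ * f T.toBlocks₂₂ = (f T.toBlocks₂₂)ᵀ * f T.toBlocks₁₂ ∧
    (f T.toBlocks₁₁)ᵀ * f T.toBlocks₂₂ - (f T.toBlocks₂₁)ᵀ * f T.toBlocks₁₂ = 1 ∧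
    (f T.toBlocks₂₂)ᵀ * f T.toBlocks₁₁ - (f T.toBlocks₁₂)ᵀ * f T.toBlocks₂₁ = 1 := by
  intro f T
  have h : fromBlocks T.toBlocks₁₁ T.toBlocks₁₂ T.toBlocks₂₁ T.toBlocks₂₂ ∈
      symplecticGroup (Fin d) ℝ := by
    rw [fromBlocks_toBlocks]; exact S.2
  obtain ⟨h1, h2, h3⟩ := SymplecticGroup.fromBlocks_mem_iff.1 h
  have key : ∀ X Y : Matrix (Fin d) (Fin d) ℝ, (f X)ᵀ * f Y = f (Xᵀ * Y) := fun X Y => by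
    change (X.map (Complex.ofRealHom))ᵀ * Y.map (Complex.ofRealHom) =
      (Xᵀ * Y).map Complex.ofRealHom
    rw [Matrix.map_mul, Matrix.transpose_map]
  have hsub : ∀ X Y : Matrix (Fin d) (Fin d) ℝ, f X - f Y = f (X - Y) := fun X Y => by
    ext i j; simp [f]
  have hone : f 1 = 1 := by
    ext i j; by_cases hij : i = j <;> simp [f, Matrix.one_apply, hij]
  refine ⟨by rw [key, key, h1], by rw [key, key, h2], by rw [key, key, hsub, h3, hone], ?_⟩
  rw [key, key, hsub, ← hone]
  congr 1
  have := congrArg Matrix.transpose h3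
  simpa [Matrix.transpose_sub, Matrix.transpose_mul] using this

lemma denom_transpose_mul_numer {d : ℕ} (S : symplecticGroup (Fin d) ℝ) (C : CSym d) :
    (denom S.1 C)ᵀ * numer S.1 C = (numer S.1 C)ᵀ * denom S.1 C := by
  obtain ⟨h1, h2, h3, h4⟩ := block_relations S
  have hC := toComplex_transpose C
  simp only [denom, numer, Matrix.transpose_add, Matrix.transpose_mul, hC]
  generalize toComplex C = Z at *
  linear_combination (norm := noncomm_ring) h1 + h3 * Z - Z * h4 + Z * h2 * Z

lemma denom_conjTranspose_mul_numer {d : ℕ} (S : symplecticGroup (Fin d) ℝ) (C : CSym d) :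
    (denom S.1 C)ᴴ * numer S.1 C - (numer S.1 C)ᴴ * denom S.1 C =
      (2 * Complex.I) • (C.2 : Matrix (Fin d) (Fin d) ℝ).map Complex.ofReal := by
  obtain ⟨h1, h2, h3, h4⟩ := block_relations S
  have hC := toComplex_conjTranspose C
  have hC' : (2 * Complex.I) • (C.2 : Matrix (Fin d) (Fin d) ℝ).map Complex.ofReal =
      toComplex C - (toComplex C)ᴴ := by rw [hC]; abel
  rw [hC']
  simp only [denom, numer, Matrix.conjTranspose_add, Matrix.conjTranspose_mul,
    ofReal_conjTranspose, Matrix.transpose_map] at *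
  generalize (toComplex C)ᴴ = W at *
  generalize toComplex C = Z at *
  linear_combination (norm := noncomm_ring) h1 + h3 * Z - W * h4 + W * h2 * Z

/-- The hermitian form of `ℬ > 0` is positive on nonzero complex vectors. -/
lemma posDef_complex {d : ℕ} {B : Matrix (Fin d) (Fin d) ℝ} (hB : B.PosDef) (w : Fin d → ℂ)
    (hw : w ≠ 0) : 0 < (star w ⬝ᵥ (B.map Complex.ofReal *ᵥ w)).re := by
  have h : (star w ⬝ᵥ (B.map Complex.ofReal *ᵥ w)).re =
      (fun i => (w i).re) ⬝ᵥ (B *ᵥ fun i => (w i).re) +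
        (fun i => (w i).im) ⬝ᵥ (B *ᵥ fun i => (w i).im) := by
    simp only [dotProduct, mulVec, Matrix.map_apply, Pi.star_apply, Complex.star_def,
      Complex.re_sum, Complex.mul_re, Complex.im_sum, Complex.mul_im, Complex.conj_re,
      Complex.conj_im, Complex.ofReal_re, Complex.ofReal_im]
    rw [← Finset.sum_add_distrib]
    refine Finset.sum_congr rfl fun i _ => ?_
    simp
  have hpos : ∀ x : Fin d → ℝ, 0 ≤ x ⬝ᵥ (B *ᵥ x) := fun x => by
    simpa using hB.posSemidef.dotProduct_mulVec_nonneg x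
  have hpos' : ∀ x : Fin d → ℝ, x ≠ 0 → 0 < x ⬝ᵥ (B *ᵥ x) := fun x hx => by
    simpa using hB.dotProduct_mulVec_pos hx
  rw [h]
  by_cases hr : (fun i => (w i).re) = 0
  · have hi : (fun i => (w i).im) ≠ 0 := fun hi => hw <| by
      ext i; exact Complex.ext (congrFun hr i) (congrFun hi i)
    exact add_pos_of_nonneg_of_pos (hpos _) (hpos' _ hi)
  · exact add_pos_of_pos_of_nonneg (hpos' _ hr) (hpos _)

lemma isUnit_det_denom {d : ℕ} (S : symplecticGroup (Fin d) ℝ) (C : UpperHalfSpace d) :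
    IsUnit (denom S.1 C.1).det := by
  rw [isUnit_iff_ne_zero]
  intro h0
  obtain ⟨v, hv, hPv⟩ := Matrix.exists_mulVec_eq_zero_iff.2 h0
  have h := denom_conjTranspose_mul_numer S C.1
  have h' := congrArg (fun M => star v ⬝ᵥ (M *ᵥ v)) h
  simp only [Matrix.sub_mulVec, ← Matrix.mulVec_mulVec, hPv, Matrix.mulVec_zero, sub_zero,
    Matrix.smul_mulVec, dotProduct_smul] at h'
  rw [Matrix.dotProduct_mulVec, ← Matrix.star_mulVec, hPv, star_zero, zero_dotProduct] at h'
  have hpos := posDef_complex C.2 v hv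
  rcases smul_eq_zero.1 h'.symm with h2 | h2
  · simp at h2
  · rw [h2] at hpos; simp at hpos

lemma fracMatrix_transpose {d : ℕ} (S : symplecticGroup (Fin d) ℝ) (C : UpperHalfSpace d) :
    (fracMatrix S.1 C.1)ᵀ = fracMatrix S.1 C.1 := by
  have hP := isUnit_det_denom S C
  have hPT : IsUnit ((denom S.1 C.1)ᵀ).det := by rwa [Matrix.det_transpose]
  have h := denom_transpose_mul_numer S C.1
  rw [fracMatrix, Matrix.transpose_mul, Matrix.transpose_nonsing_inv]
  calc ((denom S.1 C.1)ᵀ)⁻¹ * (numer S.1 C.1)ᵀ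
      = ((denom S.1 C.1)ᵀ)⁻¹ * ((numer S.1 C.1)ᵀ * denom S.1 C.1) * (denom S.1 C.1)⁻¹ := by
        rw [Matrix.mul_assoc, Matrix.mul_nonsing_inv_cancel_right _ _ hP]
    _ = _ := by
        rw [← h, Matrix.nonsing_inv_mul_cancel_left _ _ hPT]

lemma map_im_posDef {d : ℕ} (S : symplecticGroup (Fin d) ℝ) (C : UpperHalfSpace d) :
    ((fracMatrix S.1 C.1).map Complex.im).PosDef := by
  have hP := isUnit_det_denom S C
  have hsymm := fracMatrix_transpose S C
  refine Matrix.PosDef.of_dotProduct_mulVec_pos ?_ fun x hx => ?_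
  · ext i j
    simpa using congrArg Complex.im (congrFun (congrFun hsymm i) j)
  set M := fracMatrix S.1 C.1 with hM
  set P := denom S.1 C.1 with hPdef
  set Q := numer S.1 C.1 with hQdef
  let y : Fin d → ℂ := fun i => (x i : ℂ)
  let w : Fin d → ℂ := P⁻¹ *ᵥ y
  have hy : P *ᵥ w = y := by
    simp [w, Matrix.mulVec_mulVec, Matrix.mul_nonsing_inv _ hP]
  have hw : w ≠ 0 := fun h => hx <| by
    rw [h, Matrix.mulVec_zero] at hy
    ext i
    have := congrFun hy i
    simpa [y] using this.symm
  have hMy : M *ᵥ y = Q *ᵥ w := by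
    simp [hM, fracMatrix, w, Matrix.mulVec_mulVec, ← hPdef, ← hQdef]
  have h := congrArg (fun N => star w ⬝ᵥ (N *ᵥ w)) (denom_conjTranspose_mul_numer S C.1)
  simp only [Matrix.sub_mulVec, ← Matrix.mulVec_mulVec, Matrix.smul_mulVec, dotProduct_smul,
    dotProduct_sub] at h
  rw [← hPdef, ← hQdef, Matrix.dotProduct_mulVec, ← Matrix.star_mulVec, hy, ← hMy,
    Matrix.dotProduct_mulVec (star w), ← Matrix.star_mulVec, ← hMy] at h
  have hpos := posDef_complex C.2 w hw
  have e1 : star (M *ᵥ y) ⬝ᵥ y = star (star y ⬝ᵥ (M *ᵥ y)) := by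
    rw [Matrix.star_dotProduct]
  rw [e1] at h
  have him : (star y ⬝ᵥ (M *ᵥ y)).im = star x ⬝ᵥ (M.map Complex.im *ᵥ x) := by
    simp [dotProduct, mulVec, y]
  have h2 := congrArg Complex.im h
  simp only [smul_eq_mul, Complex.sub_im, Complex.star_def, Complex.conj_im, Complex.mul_im,
    Complex.mul_re, Complex.I_re, Complex.I_im] at h2
  norm_num at h2
  rw [← him]
  linarith

/-- The transformation `Φ_S : ℍ_d → ℍ_d`, `𝒞 ↦ (S₂₁ + S₂₂ 𝒞) (S₁₁ + S₁₂ 𝒞)⁻¹`, in the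
coordinates `(𝒜, ℬ)`, that is, (real part, imaginary part). -/
def Phi {d : ℕ} (S : symplecticGroup (Fin d) ℝ) (C : UpperHalfSpace d) : UpperHalfSpace d :=
  ⟨(⟨(fracMatrix S.1 C.1).map Complex.re, by
      ext i j
      simpa using congrArg Complex.re (congrFun (congrFun (fracMatrix_transpose S C) i) j)⟩,
    ⟨(fracMatrix S.1 C.1).map Complex.im, by
      ext i j
      simpa using congrArg Complex.im (congrFun (congrFun (fracMatrix_transpose S C) i) j)⟩),
    map_im_posDef S C⟩

lemma toComplex_Phi {d : ℕ} (S : symplecticGroup (Fin d) ℝ) (C : UpperHalfSpace d) :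
    toComplex (Phi S C : CSym d) = numer S.1 C.1 * (denom S.1 C.1)⁻¹ := by
  ext i j
  apply Complex.ext <;> simp [toComplex, Phi, fracMatrix]

lemma toComplex_injective {d : ℕ} : Function.Injective (toComplex (d := d)) := by
  intro C D h
  have h' : ∀ i j, toComplex C i j = toComplex D i j := fun i j => by rw [h]
  refine Prod.ext (Subtype.ext ?_) (Subtype.ext ?_) <;> ext i j
  · simpa [toComplex] using congrArg Complex.re (h' i j)
  · simpa [toComplex] using congrArg Complex.im (h' i j)

lemma blocks_mul {d : ℕ} (S T : Matrix (Fin d ⊕ Fin d) (Fin d ⊕ Fin d) ℝ) (C : CSym d) :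
    denom (S * T) C = S.toBlocks₁₁.map Complex.ofReal * denom T C +
        S.toBlocks₁₂.map Complex.ofReal * numer T C ∧
      numer (S * T) C = S.toBlocks₂₁.map Complex.ofReal * denom T C +
        S.toBlocks₂₂.map Complex.ofReal * numer T C := by
  have hST : S * T = fromBlocks
      (S.toBlocks₁₁ * T.toBlocks₁₁ + S.toBlocks₁₂ * T.toBlocks₂₁)
      (S.toBlocks₁₁ * T.toBlocks₁₂ + S.toBlocks₁₂ * T.toBlocks₂₂)
      (S.toBlocks₂₁ * T.toBlocks₁₁ + S.toBlocks₂₂ * T.toBlocks₂₁)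
      (S.toBlocks₂₁ * T.toBlocks₁₂ + S.toBlocks₂₂ * T.toBlocks₂₂) := by
    rw [← fromBlocks_multiply, fromBlocks_toBlocks, fromBlocks_toBlocks]
  have key : ∀ X Y Z W : Matrix (Fin d) (Fin d) ℝ, (X * Y + Z * W).map Complex.ofReal =
      X.map Complex.ofReal * Y.map Complex.ofReal +
        Z.map Complex.ofReal * W.map Complex.ofReal := fun X Y Z W => by
    ext i j
    simp [Matrix.mul_apply]
  simp only [denom, numer, hST, toBlocks_fromBlocks₁₁, toBlocks_fromBlocks₁₂,
    toBlocks_fromBlocks₂₁, toBlocks_fromBlocks₂₂, key]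
  constructor <;> noncomm_ring

/-- `Φ` is a left action of the symplectic group on the Siegel upper half space. -/
instance {d : ℕ} : MulAction (symplecticGroup (Fin d) ℝ) (UpperHalfSpace d) where
  smul := Phi
  one_smul C := by
    refine Subtype.ext (toComplex_injective ?_)
    change toComplex (Phi 1 C : CSym d) = _
    have h1 : (1 : Matrix (Fin d ⊕ Fin d) (Fin d ⊕ Fin d) ℝ) = fromBlocks 1 0 0 1 :=
      fromBlocks_one.symm
    have hd : denom (1 : symplecticGroup (Fin d) ℝ).1 C.1 = 1 := by
      rw [Submonoid.coe_one, h1, denom, toBlocks_fromBlocks₁₁, toBlocks_fromBlocks₁₂]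
      simp
    have hn : numer (1 : symplecticGroup (Fin d) ℝ).1 C.1 = toComplex C.1 := by
      rw [Submonoid.coe_one, h1, numer, toBlocks_fromBlocks₂₁, toBlocks_fromBlocks₂₂]
      simp
    rw [toComplex_Phi, hd, hn, inv_one, Matrix.mul_one]
  mul_smul S T C := by
    refine Subtype.ext (toComplex_injective ?_)
    change toComplex (Phi (S * T) C : CSym d) = toComplex (Phi S (Phi T C) : CSym d)
    have hT := isUnit_det_denom T C
    obtain ⟨hd, hn⟩ := blocks_mul S.1 T.1 C.1
    have e1 : denom (S * T).1 C.1 = denom S.1 (Phi T C).1 * denom T.1 C.1 := by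
      rw [Submonoid.coe_mul, hd, denom.eq_1 S.1, toComplex_Phi, add_mul, Matrix.mul_assoc, Matrix.mul_assoc,
        Matrix.nonsing_inv_mul _ hT, Matrix.mul_one]
    have e2 : numer (S * T).1 C.1 = numer S.1 (Phi T C).1 * denom T.1 C.1 := by
      rw [Submonoid.coe_mul, hn, numer.eq_1 S.1, toComplex_Phi, add_mul, Matrix.mul_assoc, Matrix.mul_assoc,
        Matrix.nonsing_inv_mul _ hT, Matrix.mul_one]
    rw [toComplex_Phi, toComplex_Phi, e1, e2, Matrix.mul_inv_rev, Matrix.mul_assoc,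
      Matrix.mul_nonsing_inv_cancel_left _ _ hT]

/-! ### The Lie algebra `sym(2d, ℝ)` and its identification with `sp(ℝ^{2d})` and its dual -/

/-- `sym(2d, ℝ)`, with matrices in `d × d` blocks. -/
abbrev Sym2 (d : ℕ) : Submodule ℝ (Matrix (Fin d ⊕ Fin d) (Fin d ⊕ Fin d) ℝ) :=
  Sym (Fin d ⊕ Fin d)

/-- The matrix `𝕁 = [[0, I], [-I, 0]]`. -/
def bbJ (d : ℕ) : Matrix (Fin d ⊕ Fin d) (Fin d ⊕ Fin d) ℝ := fromBlocks 0 1 (-1) 0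

lemma bbJ_transpose (d : ℕ) : (bbJ d)ᵀ = -bbJ d := by
  simp [bbJ, fromBlocks_transpose, fromBlocks_neg]

lemma bbJ_transpose_eq (d : ℕ) : (bbJ d)ᵀ = Matrix.J (Fin d) ℝ := by
  simp [bbJ, fromBlocks_transpose, Matrix.J]

/-- The inner product `⟨ξ, η⟩ = tr (ξ η)`, identifying `sym(n, ℝ)` with its dual. -/
def pairing {n : Type} [Fintype n] (ξ η : Sym n) : ℝ :=
  ((ξ : Matrix n n ℝ) * (η : Matrix n n ℝ)).trace

/-- The Lie bracket `[ξ, η] = ξ 𝕁ᵀ η - η 𝕁ᵀ ξ` on `sym(2d, ℝ)`. -/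
def symBracket {d : ℕ} (ξ η : Sym2 d) : Sym2 d :=
  ⟨ξ.1 * (bbJ d)ᵀ * η.1 - η.1 * (bbJ d)ᵀ * ξ.1, by
    change _ᵀ = _
    simp only [Matrix.transpose_sub, Matrix.transpose_mul, Matrix.transpose_neg,
      Sym.transpose_coe, bbJ_transpose]
    noncomm_ring⟩

/-- The element `ξ̃ = 𝕁ᵀ ξ` of `sp(ℝ^{2d})` that corresponds to `ξ ∈ sym(2d, ℝ)`. -/
def tilde {d : ℕ} (ξ : Sym2 d) : Matrix (Fin d ⊕ Fin d) (Fin d ⊕ Fin d) ℝ := (bbJ d)ᵀ * ξ.1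

lemma exp_tilde_mem {d : ℕ} (ξ : Sym2 d) (ε : ℝ) :
    NormedSpace.exp (ε • tilde ξ) ∈ symplecticGroup (Fin d) ℝ := by
  rw [SymplecticGroup.mem_iff, tilde, bbJ_transpose_eq]
  set J := Matrix.J (Fin d) ℝ
  set X := ε • (J * ξ.1) with hX
  have hJ : IsUnit J := (Matrix.isUnit_iff_isUnit_det _).2 (Matrix.isUnit_det_J (Fin d) ℝ)
  have hJ' := (Matrix.isUnit_iff_isUnit_det _).1 hJ
  have hconj : J⁻¹ * X * J = -Xᵀ := by
    rw [hX, Matrix.transpose_smul, Matrix.transpose_mul, Sym.transpose_coe, Matrix.J_transpose,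
      Matrix.mul_smul, Matrix.smul_mul, ← Matrix.mul_assoc, Matrix.nonsing_inv_mul _ hJ',
      Matrix.one_mul, Matrix.mul_neg, smul_neg, neg_neg]
  have h := Matrix.exp_conj' J X hJ
  rw [hconj, Matrix.exp_neg, Matrix.exp_transpose] at h
  have h2 : NormedSpace.exp X * J = J * ((NormedSpace.exp X)ᵀ)⁻¹ := by
    rw [h, ← Matrix.mul_assoc, ← Matrix.mul_assoc, Matrix.mul_nonsing_inv _ hJ', Matrix.one_mul]
  have hu : IsUnit ((NormedSpace.exp X)ᵀ).det := by
    rw [Matrix.det_transpose]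
    exact (Matrix.isUnit_iff_isUnit_det _).1 (Matrix.isUnit_exp X)
  rw [h2, Matrix.mul_assoc, Matrix.nonsing_inv_mul _ hu, Matrix.mul_one]

/-- The one-parameter subgroup `ε ↦ exp (ε ξ̃)` of the symplectic group. -/
def oneParam {d : ℕ} (ξ : Sym2 d) (ε : ℝ) : symplecticGroup (Fin d) ℝ :=
  ⟨NormedSpace.exp (ε • tilde ξ), exp_tilde_mem ξ ε⟩

/-- The adjoint action `Ad_S ξ = S⁻ᵀ ξ S⁻¹`, transported to `sym(2d, ℝ)`. -/
def Ad {d : ℕ} (S : symplecticGroup (Fin d) ℝ) (ξ : Sym2 d) : Sym2 d :=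
  ⟨(S⁻¹).1ᵀ * ξ.1 * (S⁻¹).1, by
    change _ᵀ = _
    simp only [Matrix.transpose_mul, Matrix.transpose_transpose, Sym.transpose_coe,
      Matrix.mul_assoc]⟩

lemma tilde_Ad {d : ℕ} (S : symplecticGroup (Fin d) ℝ) (ξ : Sym2 d) :
    tilde (Ad S ξ) = S.1 * tilde ξ * (S⁻¹).1 := by
  have h : S.1 * Matrix.J (Fin d) ℝ = Matrix.J (Fin d) ℝ * (S⁻¹).1ᵀ := by
    have h1 := SymplecticGroup.mem_iff.1 S.2
    have h2 : S.1ᵀ * (S⁻¹).1ᵀ = 1 := by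
      rw [← Matrix.transpose_mul, ← Submonoid.coe_mul, inv_mul_cancel, Submonoid.coe_one,
        Matrix.transpose_one]
    conv_rhs => rw [← h1, Matrix.mul_assoc (S.1 * _), h2, Matrix.mul_one]
  simp only [tilde, Ad, bbJ_transpose_eq, ← Matrix.mul_assoc, h]

/-- The dual map `Ad*_S μ = S⁻¹ μ S⁻ᵀ`; so the coadjoint action is `Ad*_{S⁻¹} μ = S μ Sᵀ`. -/
def coAd {d : ℕ} (S : symplecticGroup (Fin d) ℝ) (μ : Sym2 d) : Sym2 d :=
  ⟨(S⁻¹).1 * μ.1 * (S⁻¹).1ᵀ, by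
    change _ᵀ = _
    simp only [Matrix.transpose_mul, Matrix.transpose_transpose, Sym.transpose_coe,
      Matrix.mul_assoc]⟩

lemma pairing_coAd {d : ℕ} (S : symplecticGroup (Fin d) ℝ) (μ ξ : Sym2 d) :
    pairing (coAd S μ) ξ = pairing μ (Ad S ξ) := by
  simp only [pairing, coAd, Ad]
  rw [Matrix.mul_assoc, Matrix.mul_assoc, Matrix.trace_mul_comm]
  simp only [Matrix.mul_assoc]

/-- The dual `ad*_ξ μ = 𝕁 ξ μ - μ ξ 𝕁` of `ad_ξ = [ξ, ·]`. -/
def adStar {d : ℕ} (ξ μ : Sym2 d) : Sym2 d :=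
  ⟨bbJ d * ξ.1 * μ.1 - μ.1 * ξ.1 * bbJ d, by
    change _ᵀ = _
    simp only [Matrix.transpose_sub, Matrix.transpose_mul, Sym.transpose_coe, bbJ_transpose]
    noncomm_ring⟩

lemma pairing_adStar {d : ℕ} (ξ μ η : Sym2 d) :
    pairing (adStar ξ μ) η = pairing μ (symBracket ξ η) := by
  simp only [pairing, adStar, symBracket, bbJ_transpose]
  have h : (bbJ d * ξ.1 * μ.1 * η.1).trace = (μ.1 * (η.1 * bbJ d * ξ.1)).trace := by
    rw [Matrix.mul_assoc, Matrix.trace_mul_comm]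
    simp only [Matrix.mul_assoc]
  have e1 : (bbJ d * ξ.1 * μ.1 - μ.1 * ξ.1 * bbJ d) * η.1 =
    bbJ d * ξ.1 * μ.1 * η.1 - μ.1 * ξ.1 * bbJ d * η.1 := by noncomm_ring
  have e2 : μ.1 * (ξ.1 * -bbJ d * η.1 - η.1 * -bbJ d * ξ.1) =
    μ.1 * (η.1 * bbJ d * ξ.1) - μ.1 * ξ.1 * bbJ d * η.1 := by noncomm_ring
  rw [e1, e2, Matrix.trace_sub, Matrix.trace_sub, h]

/-! ### Coadjoint orbits and the `(+)`-KKS form -/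

/-- The coadjoint orbit through `μ`. -/
def coadjointOrbit {d : ℕ} (μ : Sym2 d) : Set (Sym2 d) :=
  {ν | ∃ S : symplecticGroup (Fin d) ℝ, ν = coAd S μ}

/-- The tangent space at `μ` of the coadjoint orbit through `μ`: the vectors `ad*_ξ μ`. -/
def orbitTangent {d : ℕ} (μ : Sym2 d) : Set (Sym2 d) :=
  {X | ∃ ξ : Sym2 d, X = adStar ξ μ}

/-- The `(+)`-Kirillov-Kostant-Souriau form at `μ`, which sends the tangent vectors `ad*_ξ μ` and
`ad*_η μ` to `⟨μ, [ξ, η]⟩`; by `kksForm_adStar` the choice of `ξ` and `η` does not matter. -/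
def kksForm {d : ℕ} (μ : Sym2 d) (X Y : orbitTangent μ) : ℝ :=
  pairing μ (symBracket X.2.choose Y.2.choose)

lemma symBracket_swap {d : ℕ} (μ ξ η : Sym2 d) :
    pairing μ (symBracket ξ η) = -pairing μ (symBracket η ξ) := by
  simp only [pairing, symBracket]
  rw [← Matrix.trace_neg]
  congr 1
  noncomm_ring

lemma kksForm_adStar {d : ℕ} (μ ξ η : Sym2 d) :
    kksForm μ ⟨adStar ξ μ, ξ, rfl⟩ ⟨adStar η μ, η, rfl⟩ = pairing μ (symBracket ξ η) := by
  have hX : ∃ ξ', adStar ξ μ = adStar ξ' μ := ⟨ξ, rfl⟩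
  have hY : ∃ η', adStar η μ = adStar η' μ := ⟨η, rfl⟩
  change pairing μ (symBracket hX.choose hY.choose) = _
  rw [← pairing_adStar, ← hX.choose_spec, pairing_adStar, symBracket_swap, ← pairing_adStar,
    ← hY.choose_spec, pairing_adStar, ← symBracket_swap]

/-! ### Gradients and the `(+)`-Lie-Poisson bracket -/

/-- The gradient of a linear functional on `sym(n, ℝ)`: the symmetric matrix that represents it
through the pairing `tr (ξ η)`, see `pairing_grad`. -/
def grad {n : Type} [DecidableEq n] (φ : Sym n →L[ℝ] ℝ) : Sym n :=
  ⟨Matrix.of fun j k => φ ⟨(1 / 2 : ℝ) • (Matrix.single j k 1 + Matrix.single k j 1), by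
      change _ᵀ = _
      simp [Matrix.transpose_add, add_comm]⟩, by
    ext j k
    simp only [Matrix.transpose_apply, Matrix.of_apply]
    congr 3
    exact add_comm _ _⟩

lemma pairing_grad {n : Type} [Fintype n] [DecidableEq n] (φ : Sym n →L[ℝ] ℝ) (η : Sym n) :
    pairing (grad φ) η = φ η := by
  have hη : η = ∑ j, ∑ k, (η.1 k j) •
      (⟨(1 / 2 : ℝ) • (Matrix.single j k 1 + Matrix.single k j 1), by
        change _ᵀ = _
        simp [Matrix.transpose_add, add_comm]⟩ : Sym n) := by
    ext a b
    have hs : η.1 b a = η.1 a b := congrFun (congrFun η.2 a) b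
    simp [Matrix.sum_apply, Matrix.single_apply, Finset.sum_add_distrib, ite_and, hs]
    ring
  conv_rhs => rw [hη]
  simp only [map_sum, map_smul, pairing, Matrix.trace, Matrix.diag, Matrix.mul_apply, grad,
    Matrix.of_apply, smul_eq_mul]
  exact Finset.sum_congr rfl fun j _ => Finset.sum_congr rfl fun k _ => mul_comm _ _

/-- The `(+)`-Lie-Poisson bracket `{F, G}(μ) = ⟨μ, [δF/δμ, δG/δμ]⟩` on `sym(2d, ℝ)`. -/
def liePoisson {d : ℕ} (F G : Sym2 d → ℝ) (μ : Sym2 d) : ℝ :=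
  pairing μ (symBracket (grad (fderiv ℝ F μ)) (grad (fderiv ℝ G μ)))

/-! ### Symplectic form and Poisson bracket on the Siegel upper half space -/

/-- The inverse of a symmetric matrix, as a symmetric matrix. -/
def symInv {n : Type} [Fintype n] [DecidableEq n] (P : Sym n) : Sym n :=
  ⟨(P.1)⁻¹, by
    change _ᵀ = _
    rw [Matrix.transpose_nonsing_inv, Sym.transpose_coe]⟩

/-- The symplectic form `Ω = ℬ⁻¹_{lj} ℬ⁻¹_{km} dℬ_{lm} ∧ d𝒜_{jk} = - dℬ⁻¹_{jk} ∧ d𝒜_{jk}` at `C`,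
on tangent vectors `U = (U_𝒜, U_ℬ)` and `V = (V_𝒜, V_ℬ)`. -/
def Omega {d : ℕ} (C U V : CSym d) : ℝ :=
  ∑ j, ∑ k, ∑ l, ∑ m, (symInv C.2).1 l j * (symInv C.2).1 k m *
    (U.2.1 l m * V.1.1 j k - V.2.1 l m * U.1.1 j k)

section OmegaEq

open scoped Matrix.Norms.Operator

lemma fderiv_inv_entry {d : ℕ} (C : UpperHalfSpace d) (j k : Fin d) (U : CSym d) :
    fderiv ℝ (fun D : CSym d => (symInv D.2).1 j k) C.1 U =
      -((C.1.2.1)⁻¹ * U.2.1 * (C.1.2.1)⁻¹) j k := by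
  obtain ⟨u, hu⟩ := Matrix.PosDef.isUnit C.2
  have h1 := hasFDerivAt_ringInverse (𝕜 := ℝ) u
  have h2 : (Ring.inverse : Matrix (Fin d) (Fin d) ℝ → Matrix (Fin d) (Fin d) ℝ) =
      fun M => M⁻¹ := by
    ext M; rw [Matrix.nonsing_inv_eq_ringInverse]
  rw [h2, hu] at h1
  let snd : CSym d →L[ℝ] Matrix (Fin d) (Fin d) ℝ :=
    (Sym (Fin d)).subtypeL.comp (ContinuousLinearMap.snd ℝ _ _)
  let entry : Matrix (Fin d) (Fin d) ℝ →L[ℝ] ℝ :=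
    (Matrix.entryLinearMap ℝ ℝ j k).toContinuousLinearMap
  have h4 := entry.hasFDerivAt.comp C.1 (HasFDerivAt.comp C.1 h1 snd.hasFDerivAt)
  have h5 : fderiv ℝ (fun D : CSym d => (symInv D.2).1 j k) C.1 = _ := h4.fderiv
  rw [h5, ← hu, ← Matrix.coe_units_inv]
  rfl

/-- The presentation `Ω = - dℬ⁻¹_{jk} ∧ d𝒜_{jk}`. -/
lemma Omega_eq {d : ℕ} (C : UpperHalfSpace d) (U V : CSym d) :
    Omega C.1 U V = -∑ j, ∑ k,
      (fderiv ℝ (fun D : CSym d => (symInv D.2).1 j k) C.1 U * V.1.1 j k -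
        fderiv ℝ (fun D : CSym d => (symInv D.2).1 j k) C.1 V * U.1.1 j k) := by
  simp only [fderiv_inv_entry]
  simp only [Omega, symInv]
  have hs : ∀ l j, (C.1.2.1)⁻¹ l j = (C.1.2.1)⁻¹ j l := fun l j =>
    congrFun (congrFun (symInv C.1.2).2 j) l
  rw [← Finset.sum_neg_distrib]
  refine Finset.sum_congr rfl fun j _ => ?_
  rw [← Finset.sum_neg_distrib]
  refine Finset.sum_congr rfl fun k _ => ?_
  have key : ∀ W : Matrix (Fin d) (Fin d) ℝ, ((C.1.2.1)⁻¹ * W * (C.1.2.1)⁻¹) j k =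
      ∑ l, ∑ m, (C.1.2.1)⁻¹ l j * (C.1.2.1)⁻¹ k m * W l m := fun W => by
    simp only [Matrix.mul_apply, Finset.sum_mul]
    rw [Finset.sum_comm]
    refine Finset.sum_congr rfl fun l _ => Finset.sum_congr rfl fun m _ => ?_
    rw [hs l j, hs k m]; ring
  rw [key, key]
  simp only [mul_sub, Finset.sum_sub_distrib, neg_mul, Finset.sum_mul, mul_assoc]
  ring

end OmegaEq

/-- The matrix `∂F/∂𝒜` of partial derivatives in the coordinates `(𝒜, ℬ⁻¹)`. -/
def gradA {d : ℕ} (F : CSym d → ℝ) (C : CSym d) : Sym (Fin d) :=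
  grad (fderiv ℝ (fun A => F (A, C.2)) C.1)

/-- The matrix `∂F/∂ℬ⁻¹` of partial derivatives in the coordinates `(𝒜, ℬ⁻¹)`. -/
def gradBinv {d : ℕ} (F : CSym d → ℝ) (C : CSym d) : Sym (Fin d) :=
  grad (fderiv ℝ (fun P => F (C.1, symInv P)) (symInv C.2))

/-- The Poisson bracket
`{F, G} = - (∂F/∂ℬ⁻¹_{jk} ∂G/∂𝒜_{jk} - ∂G/∂ℬ⁻¹_{jk} ∂F/∂𝒜_{jk})` on `ℍ_d`. -/
def poissonH {d : ℕ} (F G : CSym d → ℝ) (C : CSym d) : ℝ :=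
  -∑ j, ∑ k, ((gradBinv F C).1 j k * (gradA G C).1 j k -
    (gradBinv G C).1 j k * (gradA F C).1 j k)

/-! ### Momentum maps -/

/-- The infinitesimal generator `ξ_ℍ(C) = d/dε Φ_{exp (ε ξ̃)}(C)` at `ε = 0`. -/
def generator {d : ℕ} (ξ : Sym2 d) (C : UpperHalfSpace d) : CSym d :=
  deriv (fun ε : ℝ => (Phi (oneParam ξ ε) C : CSym d)) 0

/-- `J : ℍ_d → sym(2d, ℝ)` is a momentum map of the action `Φ`: for every `ξ`, the function
`⟨J(·), ξ⟩` is differentiable on `ℍ_d` and `i_{ξ_ℍ} Ω = d⟨J(·), ξ⟩`. Only the restriction of `J` to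
the open set `ℍ_d` matters. -/
def IsMomentumMap {d : ℕ} (J : CSym d → Sym2 d) : Prop :=
  ∀ (ξ : Sym2 d) (C : UpperHalfSpace d),
    DifferentiableAt ℝ (fun D => pairing (J D) ξ) (C : CSym d) ∧
    ∀ V : CSym d, fderiv ℝ (fun D => pairing (J D) ξ) (C : CSym d) V =
      Omega (C : CSym d) (generator ξ C) V

/-- Equivariance `J ∘ Φ_S = Ad*_{S⁻¹} J` on `ℍ_d`. -/
def IsEquivariant {d : ℕ} (J : CSym d → Sym2 d) : Prop :=
  ∀ (S : symplecticGroup (Fin d) ℝ) (C : UpperHalfSpace d),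
    J (Phi S C : CSym d) = coAd S⁻¹ (J (C : CSym d))

/-- The covariance matrix `σ(𝒞) = [[ℬ⁻¹, ℬ⁻¹ 𝒜], [𝒜 ℬ⁻¹, 𝒜 ℬ⁻¹ 𝒜 + ℬ]]`. -/
def sigma {d : ℕ} (C : CSym d) : Sym2 d :=
  ⟨fromBlocks (C.2.1)⁻¹ ((C.2.1)⁻¹ * C.1.1) (C.1.1 * (C.2.1)⁻¹)
      (C.1.1 * (C.2.1)⁻¹ * C.1.1 + C.2.1), by
    change _ᵀ = _
    simp only [fromBlocks_transpose, Matrix.transpose_add, Matrix.transpose_mul,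
      Matrix.transpose_nonsing_inv, Sym.transpose_coe, Matrix.mul_assoc]⟩

end Siegel

end

/-
With `f = [1; 𝒞]` and `P = ℬ⁻¹` one has `σ(𝒞) + i 𝕁ᵀ = f P fᴴ`, while `S f` is the matrix `f` of
`Φ_S(𝒞)` times `S₁₁ + S₁₂ 𝒞`; together these give the equivariance of `σ`. The infinitesimal
generator is `ξ_ℍ(𝒞) = fᵀ ξ f`, so every tangent vector of `ℍ_d` is a generator,
`Ω(ξ_ℍ, η_ℍ) = ⟨σ, [ξ, η]⟩`, and differentiating the equivariance gives `dσ(ξ_ℍ) = -ad*_ξ σ`. Hence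
the momentum map identity, the Poisson property and the pullback of the KKS form need only be
checked on generators. The constant by which two equivariant momentum maps differ is fixed by the
coadjoint action, hence zero.
-/

namespace Siegel

section InjectiveLinearMap

variable {𝕜 E F G : Type*} [NontriviallyNormedField 𝕜] [CompleteSpace 𝕜]
  [NormedAddCommGroup E] [NormedSpace 𝕜 E] [NormedAddCommGroup F] [NormedSpace 𝕜 F]
  [NormedAddCommGroup G] [NormedSpace 𝕜 G] [FiniteDimensional 𝕜 G]

lemma exists_hasFDerivAt_of_injective_comp {L : F →ₗ[𝕜] G} (hL : Function.Injective L)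
    {f : E → F} {f' : E →L[𝕜] G} {x : E} (h : HasFDerivAt (fun y => L (f y)) f' x) :
    ∃ g' : E →L[𝕜] F, HasFDerivAt f g' x ∧ ∀ v, L (g' v) = f' v := by
  have : FiniteDimensional 𝕜 F := Module.Finite.of_injective L hL
  obtain ⟨M, hM⟩ := L.exists_leftInverse_of_injective (LinearMap.ker_eq_bot.2 hL)
  have hML : ∀ y, M (L y) = y := LinearMap.congr_fun hM
  have hf : HasFDerivAt f (M.toContinuousLinearMap ∘L f') x := by
    simpa only [Function.comp_def, LinearMap.coe_toContinuousLinearMap', hML] using!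
      M.toContinuousLinearMap.hasFDerivAt.comp x h
  exact ⟨_, hf, DFunLike.congr_fun ((L.toContinuousLinearMap.hasFDerivAt.comp x hf).unique h)⟩

lemma exists_hasDerivAt_of_injective_comp {L : F →ₗ[𝕜] G} (hL : Function.Injective L)
    {f : 𝕜 → F} {f' : G} {x : 𝕜} (h : HasDerivAt (fun y => L (f y)) f' x) :
    ∃ g', HasDerivAt f g' x ∧ L g' = f' := by
  obtain ⟨g', hg', hval⟩ := exists_hasFDerivAt_of_injective_comp hL h.hasFDerivAt
  exact ⟨g' 1, hg'.hasDerivAt, by simp [hval]⟩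

lemma hasDerivAt_comp_isLinearMap [FiniteDimensional 𝕜 E] {L : E → F} (hL : IsLinearMap 𝕜 L)
    {γ : 𝕜 → E} {γ' : E} {t : 𝕜} (h : HasDerivAt γ γ' t) :
    HasDerivAt (fun s => L (γ s)) (L γ') t :=
  (hL.mk' L).toContinuousLinearMap.hasFDerivAt.comp_hasDerivAt t h

end InjectiveLinearMap

section MatrixCalculus

open scoped Matrix.Norms.Operator

lemma hasFDerivAt_matrix_inv {𝕜 K n : Type*} [NontriviallyNormedField 𝕜] [NormedField K]
    [NormedAlgebra 𝕜 K] [CompleteSpace K] [Fintype n] [DecidableEq n] {M : Matrix n n K}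
    (hM : IsUnit M.det) :
    HasFDerivAt (𝕜 := 𝕜) (fun N : Matrix n n K => N⁻¹)
      (-ContinuousLinearMap.mulLeftRight 𝕜 (Matrix n n K) M⁻¹ M⁻¹) M := by
  have : @CompleteSpace (Matrix n n K) PseudoMetricSpace.toUniformSpace := Pi.complete _
  obtain ⟨u, rfl⟩ := (Matrix.isUnit_iff_isUnit_det M).2 hM
  rw [← Matrix.coe_units_inv]
  exact (hasFDerivAt_ringInverse (𝕜 := 𝕜) u).congr_of_eventuallyEq
    (.of_forall Matrix.nonsing_inv_eq_ringInverse)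

lemma differentiableAt_fromBlocks {𝕜 E m n : Type*} [NontriviallyNormedField 𝕜] [CompleteSpace 𝕜]
    [NormedAddCommGroup E] [NormedSpace 𝕜 E] [Finite m] [Finite n]
    {a : E → Matrix m m 𝕜} {b : E → Matrix m n 𝕜} {c : E → Matrix n m 𝕜} {e : E → Matrix n n 𝕜}
    {x : E} (ha : DifferentiableAt 𝕜 a x) (hb : DifferentiableAt 𝕜 b x)
    (hc : DifferentiableAt 𝕜 c x) (he : DifferentiableAt 𝕜 e x) :
    DifferentiableAt 𝕜 (fun y => fromBlocks (a y) (b y) (c y) (e y)) x := by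
  have := Fintype.ofFinite m
  have := Fintype.ofFinite n
  let L : (Matrix m m 𝕜 × Matrix m n 𝕜) × Matrix n m 𝕜 × Matrix n n 𝕜 →ₗ[𝕜]
      Matrix (m ⊕ n) (m ⊕ n) 𝕜 :=
    { toFun x := fromBlocks x.1.1 x.1.2 x.2.1 x.2.2
      map_add' x y := by simp only [Prod.fst_add, Prod.snd_add, fromBlocks_add]
      map_smul' r x := by
        simp only [Prod.smul_fst, Prod.smul_snd, fromBlocks_smul, RingHom.id_apply] }
  exact L.toContinuousLinearMap.differentiableAt.comp x ((ha.prodMk hb).prodMk (hc.prodMk he))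

end MatrixCalculus

section OfReal

variable {l m n : Type*}

lemma map_nonsing_inv {K L : Type*} [Field K] [Field L] [Fintype n] [DecidableEq n] (f : K →+* L)
    (X : Matrix n n K) : X⁻¹.map f = (X.map f)⁻¹ := by
  simp only [Matrix.inv_def, Ring.inverse_eq_inv', ← RingHom.mapMatrix_apply, ← RingHom.map_det,
    ← RingHom.map_adjugate, ← map_inv₀]
  ext
  simp

lemma ofReal_map_inv [Fintype n] [DecidableEq n] (X : Matrix n n ℝ) :
    X⁻¹.map Complex.ofReal = (X.map Complex.ofReal)⁻¹ :=
  map_nonsing_inv Complex.ofRealHom X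

lemma ofReal_map_mul [Fintype m] (X : Matrix l m ℝ) (Y : Matrix m n ℝ) :
    (X * Y).map Complex.ofReal = X.map Complex.ofReal * Y.map Complex.ofReal :=
  Matrix.map_mul (f := Complex.ofRealHom)

lemma ofReal_map_add (X Y : Matrix m n ℝ) :
    (X + Y).map Complex.ofReal = X.map Complex.ofReal + Y.map Complex.ofReal :=
  Matrix.map_add _ Complex.ofReal_add X Y

lemma ofReal_map_sub (X Y : Matrix m n ℝ) :
    (X - Y).map Complex.ofReal = X.map Complex.ofReal - Y.map Complex.ofReal :=
  Matrix.map_sub _ Complex.ofReal_sub X Y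

lemma I_smul_I_smul {V : Type*} [AddCommGroup V] [Module ℂ V] (v : V) :
    Complex.I • Complex.I • v = -v := by
  rw [smul_smul, Complex.I_mul_I, neg_one_smul]

lemma re_ofReal_map_add_I_smul (X Y : Matrix m n ℝ) :
    (X.map Complex.ofReal + Complex.I • Y.map Complex.ofReal).map Complex.re = X := by
  ext; simp

lemma im_trace_ofReal_map_add_I_smul [Fintype n] (X Y : Matrix n n ℝ) :
    (X.map Complex.ofReal + Complex.I • Y.map Complex.ofReal).trace.im = Y.trace := by
  simp [Matrix.trace]

end OfReal

section MatrixAlgebra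

lemma eq_zero_of_vecMulVec_add_vecMulVec_eq_zero {R n : Type*} [CommRing R] [NoZeroDivisors R]
    [NeZero (2 : R)] {u w : n → R} (hw : w ≠ 0) (h : vecMulVec w u + vecMulVec u w = 0) :
    u = 0 := by
  obtain ⟨i, hi⟩ := Function.ne_iff.1 hw
  have hentry (j : n) : w i * u j + u i * w j = 0 := congrFun₂ h i j
  have hui : u i = 0 := by
    have h2 : 2 * (w i * u i) = 0 := by linear_combination hentry i
    exact (mul_eq_zero.1 ((mul_eq_zero.1 h2).resolve_left two_ne_zero)).resolve_left hi
  funext j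
  exact (mul_eq_zero.1 (by simpa only [hui, zero_mul, add_zero] using hentry j)).resolve_left hi

open scoped MatrixOrder Matrix.Norms.L2Operator in
lemma exists_eq_mul_transpose_of_posDef {n : Type*} [Fintype n] [DecidableEq n]
    {M : Matrix n n ℝ} (hM : M.PosDef) : ∃ N : Matrix n n ℝ, IsUnit N.det ∧ M = N * Nᵀ := by
  obtain ⟨N, hN⟩ := CStarAlgebra.nonneg_iff_eq_star_mul_self.1 hM.posSemidef.nonneg
  rw [star_eq_conjTranspose, conjTranspose_eq_transpose_of_trivial] at hN
  have hdet := (Matrix.isUnit_iff_isUnit_det M).1 hM.isUnit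
  rw [hN, det_mul] at hdet
  exact ⟨Nᵀ, isUnit_of_mul_isUnit_left hdet, by rw [transpose_transpose, hN]⟩

end MatrixAlgebra

variable {d : ℕ}

section Frame

lemma isUnit_det_im (C : UpperHalfSpace d) : IsUnit C.1.2.1.det :=
  (Matrix.isUnit_iff_isUnit_det _).1 C.2.isUnit

/-- The matrix `[1; 𝒞]`, whose columns span the Lagrangian subspace of `ℂ²ᵈ` that is the graph
of `𝒞`. Left multiplication by `S` on such matrices linearizes `Φ_S`. -/
def frame (C : CSym d) : Matrix (Fin d ⊕ Fin d) (Fin d) ℂ := fromRows 1 (toComplex C)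

lemma map_ofReal_mul_frame (S : Matrix (Fin d ⊕ Fin d) (Fin d ⊕ Fin d) ℝ) (C : CSym d) :
    S.map Complex.ofReal * frame C = fromRows (denom S C) (numer S C) := by
  conv_lhs => rw [← fromBlocks_toBlocks S]
  rw [fromBlocks_map, frame, fromBlocks_mul_fromRows, Matrix.mul_one, Matrix.mul_one, denom, numer]

lemma map_ofReal_mul_frame_eq_frame_Phi_mul (S : symplecticGroup (Fin d) ℝ)
    (C : UpperHalfSpace d) :
    S.1.map Complex.ofReal * frame C.1 = frame (Phi S C).1 * denom S.1 C.1 := by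
  rw [map_ofReal_mul_frame, frame, fromRows_mul, toComplex_Phi, Matrix.one_mul,
    Matrix.nonsing_inv_mul_cancel_right _ _ (isUnit_det_denom S C)]

lemma ofReal_map_bbJ_transpose : (bbJ d)ᵀ.map Complex.ofReal = fromBlocks 0 (-1) 1 0 := by
  rw [bbJ, fromBlocks_transpose, fromBlocks_map]
  congr 1 <;> ext i j <;> simp [Matrix.one_apply, eq_comm, apply_ite]

lemma frame_mul_inv_im_mul_conjTranspose (C : UpperHalfSpace d) :
    frame C.1 * (C.1.2.1.map Complex.ofReal)⁻¹ * (frame C.1)ᴴ =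
      (sigma C.1).1.map Complex.ofReal + Complex.I • (bbJ d)ᵀ.map Complex.ofReal := by
  have hBP : C.1.2.1.map Complex.ofReal * C.1.2.1⁻¹.map Complex.ofReal = 1 := by
    rw [← ofReal_map_mul, Matrix.mul_nonsing_inv _ (isUnit_det_im C),
      Matrix.map_one _ Complex.ofReal_zero Complex.ofReal_one]
  have hPB := _root_.mul_eq_one_comm.1 hBP
  rw [← ofReal_map_inv, ofReal_map_bbJ_transpose, frame, fromRows_mul,
    conjTranspose_fromRows_eq_fromCols_conjTranspose, fromRows_mul_fromCols,
    toComplex_conjTranspose]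
  simp only [sigma, fromBlocks_map, ofReal_map_mul, ofReal_map_add, fromBlocks_smul,
    fromBlocks_add, toComplex, conjTranspose_one]
  generalize C.1.1.1.map Complex.ofReal = A
  generalize C.1.2.1⁻¹.map Complex.ofReal = P at *
  generalize C.1.2.1.map Complex.ofReal = B at *
  have hZP : (A + Complex.I • B) * P = A * P + Complex.I • 1 := by
    rw [Matrix.add_mul, Matrix.smul_mul, hBP]
  have hconj : A + Complex.I • B - (2 * Complex.I) • B = A - Complex.I • B := by module
  rw [hconj, Matrix.one_mul, hZP]
  congr 1
  · rw [Matrix.mul_one, smul_zero, add_zero]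
  · rw [Matrix.mul_sub, Matrix.mul_smul, hPB, smul_neg, sub_eq_add_neg]
  · rw [Matrix.mul_one]
  · simp only [Matrix.add_mul, Matrix.mul_sub, Matrix.smul_mul, Matrix.mul_smul, Matrix.mul_assoc,
      hPB, Matrix.mul_one, Matrix.one_mul, smul_zero]
    linear_combination (norm := module) (-1 : ℂ) • I_smul_I_smul B

end Frame

section Equivariance

lemma denom_mul_inv_im_mul_conjTranspose (S : symplecticGroup (Fin d) ℝ) (C : UpperHalfSpace d) :
    denom S.1 C.1 * (C.1.2.1.map Complex.ofReal)⁻¹ * (denom S.1 C.1)ᴴ =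
      ((Phi S C).1.2.1.map Complex.ofReal)⁻¹ := by
  have hD := isUnit_det_denom S C
  have hN : numer S.1 C.1 = toComplex (Phi S C).1 * denom S.1 C.1 := by
    rw [toComplex_Phi, Matrix.nonsing_inv_mul_cancel_right _ _ hD]
  have hIm : (denom S.1 C.1)ᴴ * (Phi S C).1.2.1.map Complex.ofReal * denom S.1 C.1 =
      C.1.2.1.map Complex.ofReal := by
    refine smul_right_injective _ (mul_ne_zero two_ne_zero Complex.I_ne_zero) ?_
    dsimp only
    rw [← denom_conjTranspose_mul_numer S C.1, hN, conjTranspose_mul, toComplex_conjTranspose]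
    simp only [Matrix.mul_sub, Matrix.sub_mul, Matrix.mul_smul, Matrix.smul_mul, Matrix.mul_assoc,
      sub_sub_cancel]
  have hDH : IsUnit (denom S.1 C.1)ᴴ.det := by
    rw [det_conjTranspose]
    exact hD.star
  rw [← hIm, Matrix.mul_inv_rev, Matrix.mul_inv_rev, Matrix.mul_nonsing_inv_cancel_left _ _ hD,
    Matrix.mul_assoc, Matrix.nonsing_inv_mul _ hDH, Matrix.mul_one]

lemma sigma_Phi (S : symplecticGroup (Fin d) ℝ) (C : UpperHalfSpace d) :
    (sigma (Phi S C).1).1 = S.1 * (sigma C.1).1 * S.1ᵀ := by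
  have h : (sigma (Phi S C).1).1.map Complex.ofReal + Complex.I • (bbJ d)ᵀ.map Complex.ofReal =
      (S.1 * (sigma C.1).1 * S.1ᵀ).map Complex.ofReal +
        Complex.I • (S.1 * (bbJ d)ᵀ * S.1ᵀ).map Complex.ofReal :=
    calc
      _ = frame (Phi S C).1 * ((Phi S C).1.2.1.map Complex.ofReal)⁻¹ *
            (frame (Phi S C).1)ᴴ := (frame_mul_inv_im_mul_conjTranspose (Phi S C)).symm
      _ = frame (Phi S C).1 * denom S.1 C.1 * (C.1.2.1.map Complex.ofReal)⁻¹ *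
            (frame (Phi S C).1 * denom S.1 C.1)ᴴ := by
        rw [← denom_mul_inv_im_mul_conjTranspose]
        simp only [conjTranspose_mul, Matrix.mul_assoc]
      _ = S.1.map Complex.ofReal * (frame C.1 * (C.1.2.1.map Complex.ofReal)⁻¹ *
            (frame C.1)ᴴ) * S.1ᵀ.map Complex.ofReal := by
        rw [← map_ofReal_mul_frame_eq_frame_Phi_mul]
        simp only [conjTranspose_mul, ofReal_conjTranspose, Matrix.mul_assoc]
      _ = _ := by
        rw [frame_mul_inv_im_mul_conjTranspose, Matrix.mul_add, Matrix.add_mul, Matrix.mul_smul,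
          Matrix.smul_mul]
        simp only [ofReal_map_mul]
  simpa only [re_ofReal_map_add_I_smul] using congrArg (Matrix.map · Complex.re) h

lemma coAd_inv_coe (S : symplecticGroup (Fin d) ℝ) (μ : Sym2 d) :
    (coAd S⁻¹ μ).1 = S.1 * μ.1 * S.1ᵀ := by
  simp only [coAd, inv_inv]

lemma isEquivariant_sigma : IsEquivariant (sigma (d := d)) := fun S C =>
  Subtype.ext ((sigma_Phi S C).trans (coAd_inv_coe S _).symm)

end Equivariance

section MoebiusNumeratorDenominator

lemma isLinearMap_denom (C : CSym d) : IsLinearMap ℝ fun S => denom S C where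
  map_add S T := by
    rw [denom, denom, denom, add_add_add_comm, ← Matrix.add_mul, ← ofReal_map_add, ← ofReal_map_add]
    rfl
  map_smul r S := by
    simp only [denom, smul_add, ← Matrix.smul_mul]
    congr 2 <;> ext <;> simp [toBlocks₁₁, toBlocks₁₂]

lemma isLinearMap_numer (C : CSym d) : IsLinearMap ℝ fun S => numer S C where
  map_add S T := by
    rw [numer, numer, numer, add_add_add_comm, ← Matrix.add_mul, ← ofReal_map_add, ← ofReal_map_add]
    rfl
  map_smul r S := by
    simp only [numer, smul_add, ← Matrix.smul_mul]
    congr 2 <;> ext <;> simp [toBlocks₂₁, toBlocks₂₂]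

lemma isLinearMap_toComplex : IsLinearMap ℝ (toComplex (d := d)) where
  map_add C D := by ext; simp [toComplex]; ring
  map_smul r C := by ext; simp [toComplex]; ring

lemma denom_one (C : CSym d) : denom 1 C = 1 := by
  rw [← fromBlocks_one, denom, toBlocks_fromBlocks₁₁, toBlocks_fromBlocks₁₂]
  simp

lemma numer_one (C : CSym d) : numer 1 C = toComplex C := by
  rw [← fromBlocks_one, numer, toBlocks_fromBlocks₂₁, toBlocks_fromBlocks₂₂]
  simp

lemma numer_tilde_sub (ξ : Sym2 d) (C : CSym d) :
    numer (tilde ξ) C - toComplex C * denom (tilde ξ) C =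
      (frame C)ᵀ * ξ.1.map Complex.ofReal * frame C := by
  have hJ : fromCols (-toComplex C) (1 : Matrix (Fin d) (Fin d) ℂ) *
      (bbJ d)ᵀ.map Complex.ofReal = (frame C)ᵀ := by
    rw [ofReal_map_bbJ_transpose, fromCols_mul_fromBlocks, frame, transpose_fromRows,
      toComplex_transpose]
    simp
  calc
    _ = fromCols (-toComplex C) (1 : Matrix (Fin d) (Fin d) ℂ) *
          fromRows (denom (tilde ξ) C) (numer (tilde ξ) C) := by
      rw [fromCols_mul_fromRows, Matrix.neg_mul, Matrix.one_mul, neg_add_eq_sub]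
    _ = _ := by
      rw [← map_ofReal_mul_frame, tilde, ofReal_map_mul, ← Matrix.mul_assoc, ← Matrix.mul_assoc,
        hJ]

end MoebiusNumeratorDenominator

section Generator

open scoped Matrix.Norms.Operator

lemma oneParam_zero (ξ : Sym2 d) : oneParam ξ 0 = 1 :=
  Subtype.ext (by simp only [oneParam, zero_smul, NormedSpace.exp_zero, OneMemClass.coe_one])

lemma hasDerivAt_oneParam (ξ : Sym2 d) : HasDerivAt (fun ε => (oneParam ξ ε).1) (tilde ξ) 0 := by
  have h := hasDerivAt_exp_smul_const (𝕂 := ℝ) (tilde ξ) 0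
  rw [zero_smul, NormedSpace.exp_zero, one_mul] at h
  exact h

lemma hasDerivAt_toComplex_Phi_oneParam (ξ : Sym2 d) (C : UpperHalfSpace d) :
    HasDerivAt (fun ε => toComplex (Phi (oneParam ξ ε) C).1)
      ((frame C.1)ᵀ * ξ.1.map Complex.ofReal * frame C.1) 0 := by
  have hN := hasDerivAt_comp_isLinearMap (isLinearMap_numer C.1) (hasDerivAt_oneParam ξ)
  have hD := hasDerivAt_comp_isLinearMap (isLinearMap_denom C.1) (hasDerivAt_oneParam ξ)
  have hDinv := (hasFDerivAt_matrix_inv (𝕜 := ℝ)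
    (isUnit_det_denom (oneParam ξ 0) C)).comp_hasDerivAt 0 hD
  have h := hN.mul hDinv
  simp only [toComplex_Phi]
  convert! h using 1
  rw [← numer_tilde_sub]
  simp [oneParam_zero, denom_one, numer_one, sub_eq_add_neg]

lemma hasDerivAt_Phi_oneParam (ξ : Sym2 d) (C : UpperHalfSpace d) :
    HasDerivAt (fun ε => (Phi (oneParam ξ ε) C).1) (generator ξ C) 0 := by
  obtain ⟨_, hΦ, _⟩ := exists_hasDerivAt_of_injective_comp
    (L := isLinearMap_toComplex.mk' toComplex) toComplex_injective
    (hasDerivAt_toComplex_Phi_oneParam ξ C)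
  exact hΦ.differentiableAt.hasDerivAt

lemma toComplex_generator (ξ : Sym2 d) (C : UpperHalfSpace d) :
    toComplex (generator ξ C) = (frame C.1)ᵀ * ξ.1.map Complex.ofReal * frame C.1 :=
  (hasDerivAt_comp_isLinearMap isLinearMap_toComplex (hasDerivAt_Phi_oneParam ξ C)).unique
    (hasDerivAt_toComplex_Phi_oneParam ξ C)

lemma exists_generator_eq (C : UpperHalfSpace d) (U : CSym d) : ∃ ξ, generator ξ C = U := by
  -- The equation `fᵀ ξ f = U` for `ξ = [a, b; bᵀ, 0]` reads `a + b 𝒞 + 𝒞 bᵀ = U`.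
  let b : Matrix (Fin d) (Fin d) ℝ := (1 / 2 : ℝ) • (U.2.1 * C.1.2.1⁻¹)
  have hbB : b * C.1.2.1 = (1 / 2 : ℝ) • U.2.1 := by
    rw [Matrix.smul_mul, Matrix.nonsing_inv_mul_cancel_right _ _ (isUnit_det_im C)]
  have hBb : C.1.2.1 * bᵀ = (1 / 2 : ℝ) • U.2.1 := by
    rw [← Sym.transpose_coe C.1.2, ← transpose_mul, hbB, transpose_smul, Sym.transpose_coe]
  let ξ : Sym2 d := ⟨fromBlocks (U.1.1 - b * C.1.1.1 - C.1.1.1 * bᵀ) b bᵀ 0, by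
    change _ᵀ = _
    simp only [fromBlocks_transpose, transpose_sub, transpose_mul, transpose_transpose,
      Sym.transpose_coe, transpose_zero, sub_right_comm]⟩
  refine ⟨ξ, toComplex_injective ?_⟩
  rw [toComplex_generator]
  have hre : U.1.1 - b * C.1.1.1 - C.1.1.1 * bᵀ + b * C.1.1.1 + C.1.1.1 * bᵀ = U.1.1 := by abel
  have him : b * C.1.2.1 + C.1.2.1 * bᵀ = U.2.1 := by
    rw [hbB, hBb, ← add_smul, add_halves, one_smul]
  calc
    _ = (U.1.1 - b * C.1.1.1 - C.1.1.1 * bᵀ).map Complex.ofReal +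
          b.map Complex.ofReal * toComplex C.1 + toComplex C.1 * bᵀ.map Complex.ofReal := by
      rw [frame, transpose_fromRows, toComplex_transpose, fromBlocks_map, Matrix.mul_assoc,
        fromBlocks_mul_fromRows, fromCols_mul_fromRows, transpose_one, Matrix.one_mul,
        Matrix.mul_one, Matrix.mul_one, Matrix.map_zero _ Complex.ofReal_zero, Matrix.zero_mul,
        add_zero]
    _ = toComplex U := by
      conv_rhs => rw [toComplex, ← hre, ← him]
      simp only [toComplex, ofReal_map_add, ofReal_map_mul, Matrix.mul_add, Matrix.add_mul,
        Matrix.mul_smul, Matrix.smul_mul, smul_add]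
      abel

end Generator

section Derivative

open scoped Matrix.Norms.Operator

lemma hasDerivAt_coAd_oneParam_inv (ξ μ : Sym2 d) :
    HasDerivAt (fun ε => coAd (oneParam ξ ε)⁻¹ μ) (-adStar ξ μ) 0 := by
  have hT := hasDerivAt_comp_isLinearMap (L := Matrix.transpose)
    ⟨transpose_add, transpose_smul⟩ (hasDerivAt_oneParam ξ)
  have h : HasDerivAt (fun ε => (Sym (Fin d ⊕ Fin d)).subtype (coAd (oneParam ξ ε)⁻¹ μ))
      (tilde ξ * μ.1 + μ.1 * (tilde ξ)ᵀ) 0 := by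
    simp only [Submodule.subtype_apply, coAd_inv_coe]
    simpa only [oneParam_zero, OneMemClass.coe_one, transpose_one, Matrix.mul_one,
      Matrix.one_mul] using! ((hasDerivAt_oneParam ξ).mul_const μ.1).mul hT
  obtain ⟨ν, hν, hval⟩ := exists_hasDerivAt_of_injective_comp Subtype.val_injective h
  have hν_eq : ν = -adStar ξ μ := by
    refine Subtype.ext (hval.trans ?_)
    simp only [tilde, bbJ_transpose, adStar, transpose_mul, transpose_neg, Sym.transpose_coe,
      NegMemClass.coe_neg, Matrix.neg_mul, Matrix.mul_neg, neg_neg, neg_sub, neg_add_eq_sub,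
      Matrix.mul_assoc]
  exact hν_eq ▸ hν

lemma differentiableAt_sigma (C : UpperHalfSpace d) : DifferentiableAt ℝ sigma C.1 := by
  let re : CSym d →L[ℝ] Matrix (Fin d) (Fin d) ℝ :=
    (Sym (Fin d)).subtypeL ∘L ContinuousLinearMap.fst ℝ _ _
  let im : CSym d →L[ℝ] Matrix (Fin d) (Fin d) ℝ :=
    (Sym (Fin d)).subtypeL ∘L ContinuousLinearMap.snd ℝ _ _
  have hA : DifferentiableAt ℝ (fun D : CSym d => D.1.1) C.1 := re.differentiableAt
  have hB : DifferentiableAt ℝ (fun D : CSym d => D.2.1) C.1 := im.differentiableAt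
  have hP : DifferentiableAt ℝ (fun D : CSym d => D.2.1⁻¹) C.1 :=
    (hasFDerivAt_matrix_inv (𝕜 := ℝ) (isUnit_det_im C)).differentiableAt.comp C.1 hB
  have h := differentiableAt_fromBlocks hP (hP.mul hA) (hA.mul hP) (((hA.mul hP).mul hA).add hB)
  obtain ⟨_, hσ, _⟩ := exists_hasFDerivAt_of_injective_comp
    (L := (Sym (Fin d ⊕ Fin d)).subtype) Subtype.val_injective (f := sigma) h.hasFDerivAt
  exact hσ.differentiableAt

lemma fderiv_sigma_generator (ξ : Sym2 d) (C : UpperHalfSpace d) :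
    fderiv ℝ sigma C.1 (generator ξ C) = -adStar ξ (sigma C.1) := by
  have h0 : Phi (oneParam ξ 0) C = C := by
    rw [oneParam_zero]
    exact one_smul (symplecticGroup (Fin d) ℝ) C
  have h : HasDerivAt (fun ε => sigma (Phi (oneParam ξ ε) C).1)
      (fderiv ℝ sigma C.1 (generator ξ C)) 0 := by
    refine HasFDerivAt.comp_hasDerivAt (l := sigma) 0 ?_ (hasDerivAt_Phi_oneParam ξ C)
    rw [h0]
    exact (differentiableAt_sigma C).hasFDerivAt
  simp only [isEquivariant_sigma _ C] at h
  exact h.unique (hasDerivAt_coAd_oneParam_inv ξ (sigma C.1))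

end Derivative

section SymplecticForm

lemma Omega_eq_trace (C U V : CSym d) :
    Omega C U V =
      (C.2.1⁻¹ * U.2.1 * C.2.1⁻¹ * V.1.1 - C.2.1⁻¹ * U.1.1 * C.2.1⁻¹ * V.2.1).trace := by
  have hP : ∀ j k, C.2.1⁻¹ j k = C.2.1⁻¹ k j := fun j k => congrFun₂ (symInv C.2).2 k j
  have key (X Y : Sym (Fin d)) : (C.2.1⁻¹ * X.1 * C.2.1⁻¹ * Y.1).trace =
      ∑ j, ∑ k, ∑ l, ∑ m, C.2.1⁻¹ l j * C.2.1⁻¹ k m * (X.1 l m * Y.1 j k) := by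
    simp only [Matrix.trace, Matrix.diag, Matrix.mul_apply, Finset.sum_mul]
    refine Finset.sum_congr rfl fun j _ => Finset.sum_congr rfl fun k _ => ?_
    rw [Finset.sum_comm]
    refine Finset.sum_congr rfl fun l _ => Finset.sum_congr rfl fun m _ => ?_
    rw [hP l j, hP k m, show Y.1 k j = Y.1 j k from congrFun₂ Y.2 j k]
    ring
  have hswap : (C.2.1⁻¹ * U.1.1 * C.2.1⁻¹ * V.2.1).trace =
      (C.2.1⁻¹ * V.2.1 * C.2.1⁻¹ * U.1.1).trace := by
    rw [Matrix.mul_assoc, Matrix.trace_mul_comm, ← Matrix.mul_assoc]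
  rw [Matrix.trace_sub, hswap, key, key]
  simp only [Omega, symInv, mul_sub, Finset.sum_sub_distrib]

lemma Omega_eq_im_trace (C U V : CSym d) :
    Omega C U V = ((C.2.1.map Complex.ofReal)⁻¹ * toComplex U * (C.2.1.map Complex.ofReal)⁻¹ *
      (toComplex V)ᴴ).trace.im := by
  have hconj : (toComplex V)ᴴ =
      V.1.1.map Complex.ofReal - Complex.I • V.2.1.map Complex.ofReal := by
    rw [toComplex_conjTranspose, toComplex]
    module
  rw [Omega_eq_trace, hconj, toComplex, ← ofReal_map_inv,
    ← im_trace_ofReal_map_add_I_smul (C.2.1⁻¹ * U.1.1 * C.2.1⁻¹ * V.1.1 +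
      C.2.1⁻¹ * U.2.1 * C.2.1⁻¹ * V.2.1)]
  congr 2
  simp only [ofReal_map_add, ofReal_map_sub, ofReal_map_mul, Matrix.mul_add, Matrix.mul_sub,
    Matrix.add_mul, Matrix.mul_smul, Matrix.smul_mul, smul_sub, smul_add, I_smul_I_smul]
  abel

lemma Omega_generator_generator (C : UpperHalfSpace d) (ξ η : Sym2 d) :
    Omega C.1 (generator ξ C) (generator η C) = pairing (sigma C.1) (symBracket ξ η) := by
  set f := frame C.1
  set P := (C.1.2.1.map Complex.ofReal)⁻¹ with hPdef
  set σ := (sigma C.1).1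
  have hσ : f * P * fᴴ = σ.map Complex.ofReal + Complex.I • (bbJ d)ᵀ.map Complex.ofReal :=
    frame_mul_inv_im_mul_conjTranspose C
  have hσT : fᵀᴴ * P * fᵀ = σ.map Complex.ofReal + Complex.I • (bbJ d).map Complex.ofReal := by
    have hP : Pᵀ = P := by
      rw [hPdef, transpose_nonsing_inv, ← transpose_map, Sym.transpose_coe]
    have h := congrArg Matrix.transpose hσ
    rw [transpose_mul, transpose_mul, hP, transpose_add, transpose_smul, ← transpose_map,
      ← transpose_map, transpose_transpose, Sym.transpose_coe, ← Matrix.mul_assoc] at h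
    exact h
  calc
    _ = (P * (fᵀ * ξ.1.map Complex.ofReal * f) * P *
          (fᴴ * η.1.map Complex.ofReal * fᵀᴴ)).trace.im := by
      rw [Omega_eq_im_trace, toComplex_generator, toComplex_generator,
        conjTranspose_mul, conjTranspose_mul, ofReal_conjTranspose, Sym.transpose_coe,
        ← Matrix.mul_assoc fᴴ]
    _ = ((fᵀᴴ * P * fᵀ) * ξ.1.map Complex.ofReal * (f * P * fᴴ) *
          η.1.map Complex.ofReal).trace.im := by
      rw [← Matrix.mul_assoc _ (fᴴ * _), Matrix.trace_mul_comm]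
      simp only [Matrix.mul_assoc]
    _ = (bbJ d * ξ.1 * σ * η.1 + σ * ξ.1 * (bbJ d)ᵀ * η.1).trace := by
      rw [hσ, hσT, ← im_trace_ofReal_map_add_I_smul (σ * ξ.1 * σ * η.1 -
        bbJ d * ξ.1 * (bbJ d)ᵀ * η.1)]
      congr 2
      simp only [ofReal_map_add, ofReal_map_sub, ofReal_map_mul, Matrix.mul_add, Matrix.add_mul,
        Matrix.mul_smul, Matrix.smul_mul, smul_add, I_smul_I_smul, Matrix.neg_mul]
      abel
    _ = pairing (sigma C.1) (symBracket ξ η) := by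
      rw [← pairing_adStar, pairing, adStar, bbJ_transpose, Matrix.mul_neg, Matrix.neg_mul,
        ← sub_eq_add_neg, ← Matrix.sub_mul]

lemma isLinearMap_pairing_left {n : Type} [Fintype n] (ξ : Sym n) :
    IsLinearMap ℝ fun μ => pairing μ ξ where
  map_add μ ν := by simp only [pairing, Submodule.coe_add, Matrix.add_mul, Matrix.trace_add]
  map_smul r μ := by simp only [pairing, Submodule.coe_smul, Matrix.smul_mul, Matrix.trace_smul]

lemma Omega_generator_left (C : UpperHalfSpace d) (ξ : Sym2 d) (V : CSym d) :
    Omega C.1 (generator ξ C) V = pairing (fderiv ℝ sigma C.1 V) ξ := by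
  obtain ⟨η, rfl⟩ := exists_generator_eq C V
  rw [Omega_generator_generator, symBracket_swap, ← pairing_adStar, fderiv_sigma_generator,
    (isLinearMap_pairing_left ξ).map_neg]

end SymplecticForm

section MomentumMap

open scoped Matrix.Norms.Operator

lemma pairing_left_ext {n : Type} [Fintype n] {ξ η : Sym n}
    (h : ∀ ζ, pairing ξ ζ = pairing η ζ) : ξ = η := by
  refine sub_eq_zero.1 (Subtype.ext (Matrix.trace_conjTranspose_mul_self_eq_zero_iff.1 ?_))
  rw [conjTranspose_eq_transpose_of_trivial, Sym.transpose_coe]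
  exact ((isLinearMap_pairing_left (ξ - η)).map_sub ξ η).trans (sub_eq_zero.2 (h _))

lemma hasFDerivAt_pairing_sigma (ξ : Sym2 d) (C : UpperHalfSpace d) :
    HasFDerivAt (fun D => pairing (sigma D) ξ)
      (((isLinearMap_pairing_left ξ).mk' _).toContinuousLinearMap ∘L fderiv ℝ sigma C.1) C.1 :=
  ((isLinearMap_pairing_left ξ).mk' _).toContinuousLinearMap.hasFDerivAt.comp C.1
    (differentiableAt_sigma C).hasFDerivAt

lemma isMomentumMap_sigma : IsMomentumMap (sigma (d := d)) := fun ξ C =>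
  ⟨(hasFDerivAt_pairing_sigma ξ C).differentiableAt, fun V => by
    rw [Omega_generator_left, (hasFDerivAt_pairing_sigma ξ C).fderiv]
    rfl⟩

lemma convex_upperHalfSpace : Convex ℝ (UpperHalfSpace d) :=
  convex_iff_forall_pos.2 fun _ hC _ hD _ _ hs ht _ => (hC.smul hs).add (hD.smul ht)

lemma IsMomentumMap.sub_eq_sub {J K : CSym d → Sym2 d} (hJ : IsMomentumMap J)
    (hK : IsMomentumMap K) (C D : UpperHalfSpace d) : J C.1 - K C.1 = J D.1 - K D.1 := by
  refine pairing_left_ext fun ξ => ?_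
  have hderiv (X : CSym d) (hX : X ∈ UpperHalfSpace d) :
      HasFDerivAt (fun Y => pairing (J Y - K Y) ξ) (0 : CSym d →L[ℝ] ℝ) X := by
    obtain ⟨hJd, hJX⟩ := hJ ξ ⟨X, hX⟩
    obtain ⟨hKd, hKX⟩ := hK ξ ⟨X, hX⟩
    simp only [(isLinearMap_pairing_left ξ).map_sub]
    convert! hJd.hasFDerivAt.sub hKd.hasFDerivAt using 1
    exact (sub_eq_zero.2 (ContinuousLinearMap.ext fun V => (hJX V).trans (hKX V).symm)).symm
  have h := convex_upperHalfSpace.norm_image_sub_le_of_norm_hasFDerivWithin_le (C := 0)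
    (fun X hX => (hderiv X hX).hasFDerivWithinAt) (fun _ _ => norm_zero.le) D.2 C.2
  rw [zero_mul, norm_le_zero_iff, sub_eq_zero] at h
  exact h

lemma IsMomentumMap.exists_eq_sigma_add {J : CSym d → Sym2 d} (hJ : IsMomentumMap J) :
    ∃ c, ∀ C : UpperHalfSpace d, J C.1 = sigma C.1 + c := by
  let i : UpperHalfSpace d := ⟨(0, ⟨1, Matrix.isSymm_one⟩), Matrix.PosDef.one⟩
  exact ⟨J i.1 - sigma i.1, fun C => by
    rw [← hJ.sub_eq_sub isMomentumMap_sigma C i, add_sub_cancel]⟩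

end MomentumMap

section FixedPoints

open scoped Matrix.Norms.Operator

lemma eq_zero_of_forall_adStar_eq_zero {μ : Sym2 d} (h : ∀ ξ, adStar ξ μ = 0) : μ = 0 := by
  have hJ : IsUnit (bbJ d) := by
    have hJT : IsUnit (bbJ d)ᵀ := by
      rw [bbJ_transpose_eq, Matrix.isUnit_iff_isUnit_det]
      exact Matrix.isUnit_det_J (Fin d) ℝ
    rwa [bbJ_transpose, IsUnit.neg_iff] at hJT
  have hker (v : Fin d ⊕ Fin d → ℝ) : μ.1 *ᵥ v = 0 := by
    by_cases hv : v = 0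
    · rw [hv, Matrix.mulVec_zero]
    have hJv : bbJ d *ᵥ v ≠ 0 := fun h0 =>
      hv (Matrix.mulVec_injective_of_isUnit hJ (h0.trans (Matrix.mulVec_zero _).symm))
    refine eq_zero_of_vecMulVec_add_vecMulVec_eq_zero hJv ?_
    have hξ := congrArg Subtype.val (h ⟨vecMulVec v v, transpose_vecMulVec v v⟩)
    have hvμ : v ᵥ* μ.1 = μ.1 *ᵥ v := by rw [← Matrix.mulVec_transpose, Sym.transpose_coe]
    have hvJ : v ᵥ* bbJ d = -(bbJ d *ᵥ v) := by
      rw [← Matrix.mulVec_transpose, bbJ_transpose, Matrix.neg_mulVec]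
    simpa only [adStar, mul_vecMulVec, vecMulVec_mul, hvμ, hvJ, vecMulVec_neg, sub_neg_eq_add,
      ZeroMemClass.coe_zero] using hξ
  exact Subtype.ext (Matrix.ext_of_mulVec_single fun i => by
    rw [hker, ZeroMemClass.coe_zero, Matrix.zero_mulVec])

lemma eq_zero_of_forall_coAd_inv_eq {μ : Sym2 d}
    (h : ∀ S : symplecticGroup (Fin d) ℝ, coAd S⁻¹ μ = μ) : μ = 0 := by
  refine eq_zero_of_forall_adStar_eq_zero fun ξ => neg_eq_zero.1 ?_
  have hconst := hasDerivAt_coAd_oneParam_inv ξ μ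
  simp only [h] at hconst
  exact hconst.unique (hasDerivAt_const 0 μ)

lemma coAd_sub (S : symplecticGroup (Fin d) ℝ) (μ ν : Sym2 d) :
    coAd S (μ - ν) = coAd S μ - coAd S ν :=
  Subtype.ext (by
    simp only [coAd, AddSubgroupClass.coe_sub, Matrix.mul_sub, Matrix.sub_mul])

lemma IsMomentumMap.eq_of_isEquivariant {J K : CSym d → Sym2 d} (hJ : IsMomentumMap J)
    (hK : IsMomentumMap K) (hJe : IsEquivariant J) (hKe : IsEquivariant K)
    (C : UpperHalfSpace d) : J C.1 = K C.1 := by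
  refine sub_eq_zero.1 (eq_zero_of_forall_coAd_inv_eq fun S => ?_)
  rw [coAd_sub, ← hJe S C, ← hKe S C, hJ.sub_eq_sub hK]

end FixedPoints

section CoadjointOrbit

lemma exists_sigma_eq_mul_transpose (C : UpperHalfSpace d) :
    ∃ S : symplecticGroup (Fin d) ℝ, (sigma C.1).1 = S.1 * S.1ᵀ := by
  obtain ⟨N, hNdet, hB⟩ := exists_eq_mul_transpose_of_posDef C.2
  have hA : C.1.1.1ᵀ = C.1.1.1 := Sym.transpose_coe C.1.1
  refine ⟨⟨fromBlocks N⁻¹ᵀ 0 (C.1.1.1 * N⁻¹ᵀ) N, SymplecticGroup.fromBlocks_mem_iff.2 ⟨?_, ?_, ?_⟩⟩,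
    ?_⟩
  · simp only [transpose_mul, transpose_transpose, hA, Matrix.mul_assoc]
  · rw [transpose_zero, Matrix.zero_mul, Matrix.mul_zero]
  · rw [transpose_transpose, Matrix.nonsing_inv_mul _ hNdet, Matrix.mul_zero, sub_zero]
  · simp only [sigma, hB, Matrix.mul_inv_rev, ← transpose_nonsing_inv, fromBlocks_transpose,
      fromBlocks_multiply, transpose_mul, transpose_transpose, transpose_zero, Matrix.mul_zero,
      Matrix.zero_mul, add_zero, hA, Matrix.mul_assoc]

lemma sigma_image (C : UpperHalfSpace d) :
    sigma '' UpperHalfSpace d = coadjointOrbit (sigma C.1) := by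
  apply Set.Subset.antisymm
  · rintro _ ⟨D, hD, rfl⟩
    obtain ⟨S, hS⟩ := exists_sigma_eq_mul_transpose C
    obtain ⟨T, hT⟩ := exists_sigma_eq_mul_transpose ⟨D, hD⟩
    have hTS : (T * S⁻¹ : symplecticGroup (Fin d) ℝ).1 * S.1 = T.1 := by
      rw [← Submonoid.coe_mul, inv_mul_cancel_right]
    refine ⟨(T * S⁻¹)⁻¹, Subtype.ext ?_⟩
    rw [coAd_inv_coe, hS, ← Matrix.mul_assoc, hTS, Matrix.mul_assoc, ← transpose_mul, hTS]
    exact hT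
  · rintro _ ⟨S, rfl⟩
    exact ⟨(Phi S⁻¹ C).1, (Phi S⁻¹ C).2, by rw [isEquivariant_sigma, inv_inv]⟩

end CoadjointOrbit

section KirillovKostantSouriau

lemma adStar_neg (ξ μ : Sym2 d) : adStar (-ξ) μ = -adStar ξ μ := by
  refine Subtype.ext ?_
  simp only [adStar, NegMemClass.coe_neg]
  noncomm_ring

lemma symBracket_neg_neg (ξ η : Sym2 d) : symBracket (-ξ) (-η) = symBracket ξ η := by
  refine Subtype.ext ?_
  simp only [symBracket, NegMemClass.coe_neg]
  noncomm_ring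

lemma fderiv_sigma_mem_orbitTangent (C : UpperHalfSpace d) (U : CSym d) :
    fderiv ℝ sigma C.1 U ∈ orbitTangent (sigma C.1) := by
  obtain ⟨ξ, rfl⟩ := exists_generator_eq C U
  exact ⟨-ξ, by rw [fderiv_sigma_generator, adStar_neg]⟩

lemma kksForm_fderiv_sigma (C : UpperHalfSpace d) (U V : CSym d) :
    kksForm (sigma C.1) ⟨fderiv ℝ sigma C.1 U, fderiv_sigma_mem_orbitTangent C U⟩
      ⟨fderiv ℝ sigma C.1 V, fderiv_sigma_mem_orbitTangent C V⟩ = Omega C.1 U V := by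
  obtain ⟨ξ, rfl⟩ := exists_generator_eq C U
  obtain ⟨η, rfl⟩ := exists_generator_eq C V
  simp only [fderiv_sigma_generator, ← adStar_neg]
  rw [kksForm_adStar, symBracket_neg_neg, Omega_generator_generator]

end KirillovKostantSouriau

lemma pairing_comm {n : Type} [Fintype n] (ξ η : Sym n) : pairing ξ η = pairing η ξ :=
  Matrix.trace_mul_comm _ _

lemma pairing_eq_sum {n : Type} [Fintype n] (ξ η : Sym n) :
    pairing ξ η = ∑ j, ∑ k, ξ.1 j k * η.1 j k := by
  simp only [pairing, Matrix.trace, Matrix.diag, Matrix.mul_apply]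
  exact Finset.sum_congr rfl fun j _ => Finset.sum_congr rfl fun k _ =>
    congrArg (ξ.1 j k * ·) (congrFun₂ η.2 j k)

lemma poissonH_eq_pairing (F G : CSym d → ℝ) (C : CSym d) :
    poissonH F G C = pairing (gradA F C) (gradBinv G C) - pairing (gradBinv F C) (gradA G C) := by
  rw [pairing_comm (gradA F C)]
  simp only [poissonH, pairing_eq_sum, Finset.sum_sub_distrib, neg_sub]

lemma symInv_symInv {n : Type} [Fintype n] [DecidableEq n] {P : Sym n} (hP : IsUnit P.1.det) :
    symInv (symInv P) = P :=
  Subtype.ext (Matrix.nonsing_inv_nonsing_inv _ hP)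

section PoissonBracket

open scoped Matrix.Norms.Operator

lemma exists_hasFDerivAt_symInv {n : Type} [Fintype n] [DecidableEq n] {P : Sym n}
    (hP : IsUnit P.1.det) :
    ∃ D : Sym n →L[ℝ] Sym n, HasFDerivAt symInv D P ∧ ∀ W, (D W).1 = -(P.1⁻¹ * W.1 * P.1⁻¹) :=
  exists_hasFDerivAt_of_injective_comp (L := (Sym n).subtype) (f := symInv)
    (Sym n).injective_subtype
    ((hasFDerivAt_matrix_inv (𝕜 := ℝ) hP).comp P (Sym n).subtypeL.hasFDerivAt)

lemma gradA_coe {K : CSym d → ℝ} {C U : CSym d} (hK : DifferentiableAt ℝ K C)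
    (hU : ∀ V, fderiv ℝ K C V = Omega C U V) :
    (gradA K C).1 = C.2.1⁻¹ * U.2.1 * C.2.1⁻¹ := by
  have hsymm : (C.2.1⁻¹ * U.2.1 * C.2.1⁻¹).IsSymm := by
    rw [Matrix.IsSymm]
    simp only [transpose_mul, transpose_nonsing_inv, Sym.transpose_coe, Matrix.mul_assoc]
  refine congrArg Subtype.val (pairing_left_ext (η := ⟨_, hsymm⟩) fun W => ?_)
  have hA : HasFDerivAt (fun A => K (A, C.2)) _ C.1 :=
    hK.hasFDerivAt.comp C.1 (hasFDerivAt_prodMk_left C.1 C.2)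
  rw [gradA, pairing_grad, hA.fderiv]
  refine (hU (W, 0)).trans ?_
  rw [Omega_eq_trace, pairing, ZeroMemClass.coe_zero, Matrix.mul_zero, sub_zero]

lemma gradBinv_eq {K : CSym d → ℝ} {C : UpperHalfSpace d} {U : CSym d}
    (hK : DifferentiableAt ℝ K C.1) (hU : ∀ V, fderiv ℝ K C.1 V = Omega C.1 U V) :
    gradBinv K C.1 = U.1 := by
  have hB := isUnit_det_im C
  obtain ⟨D, hD, hDW⟩ := exists_hasFDerivAt_symInv (P := symInv C.1.2)
    (Matrix.isUnit_nonsing_inv_det_iff.2 hB)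
  have hK' : HasFDerivAt K (fderiv ℝ K C.1) (C.1.1, symInv (symInv C.1.2)) := by
    rw [symInv_symInv hB]
    exact hK.hasFDerivAt
  have hP : HasFDerivAt (fun P => K (C.1.1, symInv P)) _ (symInv C.1.2) :=
    hK'.comp (symInv C.1.2) ((hasFDerivAt_prodMk_right _ _).comp (symInv C.1.2) hD)
  refine pairing_left_ext fun W => ?_
  rw [gradBinv, pairing_grad, hP.fderiv]
  refine (hU (0, D W)).trans ?_
  have hDW' : (D W).1 = -(C.1.2.1 * W.1 * C.1.2.1) := by
    rw [hDW, symInv, Matrix.nonsing_inv_nonsing_inv _ hB]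
  rw [Omega_eq_trace, hDW', pairing, ZeroMemClass.coe_zero, Matrix.mul_zero, zero_sub,
    Matrix.mul_neg, neg_neg, ← Matrix.mul_assoc, ← Matrix.mul_assoc,
    Matrix.nonsing_inv_mul_cancel_right _ _ hB, Matrix.trace_mul_comm, ← Matrix.mul_assoc,
    ← Matrix.mul_assoc, Matrix.mul_nonsing_inv _ hB, Matrix.one_mul]

lemma poissonH_eq_Omega {K L : CSym d → ℝ} {C : UpperHalfSpace d} {U V : CSym d}
    (hK : DifferentiableAt ℝ K C.1) (hU : ∀ W, fderiv ℝ K C.1 W = Omega C.1 U W)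
    (hL : DifferentiableAt ℝ L C.1) (hV : ∀ W, fderiv ℝ L C.1 W = Omega C.1 V W) :
    poissonH K L C.1 = Omega C.1 U V := by
  have hswap : (U.1.1 * (C.1.2.1⁻¹ * V.2.1 * C.1.2.1⁻¹)).trace =
      (C.1.2.1⁻¹ * U.1.1 * C.1.2.1⁻¹ * V.2.1).trace := by
    rw [← Matrix.mul_assoc, Matrix.trace_mul_comm]
    simp only [Matrix.mul_assoc]
  rw [poissonH_eq_pairing, pairing, pairing, gradA_coe hK hU, gradA_coe hL hV, gradBinv_eq hK hU,
    gradBinv_eq hL hV, hswap, Omega_eq_trace, Matrix.trace_sub]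

lemma fderiv_comp_sigma {C : UpperHalfSpace d} {F : Sym2 d → ℝ}
    (hF : DifferentiableAt ℝ F (sigma C.1)) (V : CSym d) :
    fderiv ℝ (F ∘ sigma) C.1 V =
      Omega C.1 (generator (grad (fderiv ℝ F (sigma C.1))) C) V := by
  rw [Omega_generator_left, pairing_comm, pairing_grad]
  exact DFunLike.congr_fun (fderiv_comp C.1 hF (differentiableAt_sigma C)) V

lemma poissonH_comp_sigma {C : UpperHalfSpace d} {F G : Sym2 d → ℝ}
    (hF : DifferentiableAt ℝ F (sigma C.1)) (hG : DifferentiableAt ℝ G (sigma C.1)) :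
    poissonH (F ∘ sigma) (G ∘ sigma) C.1 = liePoisson F G (sigma C.1) := by
  have hσ := differentiableAt_sigma C
  rw [poissonH_eq_Omega (hF.comp C.1 hσ) (fderiv_comp_sigma hF) (hG.comp C.1 hσ)
    (fderiv_comp_sigma hG), Omega_generator_generator, liePoisson]

end PoissonBracket

end Siegel

theorem theorem3p2 (d : ℕ) :
    -- (i) `σ` is a momentum map of `Φ`, and a momentum map is unique up to an additive constant
    (Siegel.IsMomentumMap (Siegel.sigma (d := d)) ∧
      ∀ J : Siegel.CSym d → Siegel.Sym2 d, Siegel.IsMomentumMap J →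
        ∃ c : Siegel.Sym2 d, ∀ C : Siegel.UpperHalfSpace d, J C.1 = Siegel.sigma C.1 + c) ∧
    -- (ii) `σ` is equivariant, and it is the only equivariant momentum map of `Φ`
    (Siegel.IsEquivariant (Siegel.sigma (d := d)) ∧
      (∀ (S : Matrix.symplecticGroup (Fin d) ℝ) (C : Siegel.UpperHalfSpace d),
        (Siegel.sigma (Siegel.Phi S C).1).1 = S.1 * (Siegel.sigma C.1).1 * (S.1).transpose) ∧
      ∀ J : Siegel.CSym d → Siegel.Sym2 d, Siegel.IsMomentumMap J → Siegel.IsEquivariant J →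
        ∀ C : Siegel.UpperHalfSpace d, J C.1 = Siegel.sigma C.1) ∧
    -- (iii) `σ` is a Poisson map
    (∀ (C : Siegel.UpperHalfSpace d) (F G : Siegel.Sym2 d → ℝ),
      DifferentiableAt ℝ F (Siegel.sigma C.1) → DifferentiableAt ℝ G (Siegel.sigma C.1) →
        Siegel.liePoisson F G (Siegel.sigma C.1) =
          Siegel.poissonH (F ∘ Siegel.sigma) (G ∘ Siegel.sigma) C.1) ∧
    -- (iv) `σ` maps `ℍ_d` onto a coadjoint orbit, and pulls back its KKS form to `Ω`
    (∀ C : Siegel.UpperHalfSpace d,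
      Siegel.sigma '' Siegel.UpperHalfSpace d = Siegel.coadjointOrbit (Siegel.sigma C.1) ∧
      DifferentiableAt ℝ Siegel.sigma C.1 ∧
      ∃ hT : ∀ U : Siegel.CSym d,
          fderiv ℝ Siegel.sigma C.1 U ∈ Siegel.orbitTangent (Siegel.sigma C.1),
        ∀ U V : Siegel.CSym d,
          Siegel.kksForm (Siegel.sigma C.1) ⟨fderiv ℝ Siegel.sigma C.1 U, hT U⟩
            ⟨fderiv ℝ Siegel.sigma C.1 V, hT V⟩ = Siegel.Omega C.1 U V) :=
  ⟨⟨Siegel.isMomentumMap_sigma, fun _ hJ => hJ.exists_eq_sigma_add⟩,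
    ⟨Siegel.isEquivariant_sigma, Siegel.sigma_Phi, fun _ hJ hE =>
      hJ.eq_of_isEquivariant Siegel.isMomentumMap_sigma hE Siegel.isEquivariant_sigma⟩,
    fun _ _ _ hF hG => (Siegel.poissonH_comp_sigma hF hG).symm,
    fun C => ⟨Siegel.sigma_image C, Siegel.differentiableAt_sigma C,
      Siegel.fderiv_sigma_mem_orbitTangent C, Siegel.kksForm_fderiv_sigma C⟩⟩
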